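/- Let $P=\{x\in\mathbb{C}:\operatorname{Re}x>0\}$. If $a$ is analytic on $P$ with $|a(x)|\le Ke^{\alpha|x|}$ on $P$ for some $\alpha<\pi$ and $K>0$, let $R_a$ be the analytic function on $P$ with $R_a(x)-R_a(x+1)=a(x)$ for $x\in P$, $\int_1^2R_a(t)\,dt=0$, and $|R_a(x)|\le Le^{\beta|x|}$ on $P$ for some $\beta<2\pi$ and $L>0$; the Ramanujan sum of the series is $\sum_{n\ge1}^{\mathcal R}a(n)=R_a(1)$, and it depends only on the values $a(n)$, $n\ge1$. Let $H_n=\sum_{j=1}^n\frac1j$, let $\gamma$ be the Euler–Mascheroni constant, let $\psi=\Gamma'/\Gamma$, and let $\log$ be the principal logarithm. Then for every complex $z$ with $|z|<\pi$, the Ramanujan sum $\sum_{n\ge1}^{\mathcal R}e^{-nz}H_n$ exists, is well defined (it does not depend on the function $a$ with $a(n)=e^{-nz}H_n$, $n\ge 1$, used to interpolate the terms, nor on the choice of $R_a$), and $$\sum_{n\ge1}^{\mathcal R}e^{-nz}H_n=\frac{1}{1-e^{-z}}\log\left(\frac{z}{1-e^{-z}}\right)+\frac{1}{1-e^{-z}}\sum_{n=1}^\infty\frac{(-1)^n}{n}\frac{z^n}{n!}+\gamma\left(\frac{1}{1-e^{-z}}-\frac{e^{-z}}{z}\right)-\frac{1}{e^z-1}\int_0^1\psi(x+1)e^{-zx}\,dx,$$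 where at $z=0$ the right-hand side, which has a removable singularity there, is read as its limit for $z\to0$, $z\ne0$. -/

import Mathlib

/-- `f` is of exponential growth of order less than `τ` on the right half-plane:
there are `α < τ` and `K > 0` with `|f x| ≤ K e^{α |x|}` for all `x` with `Re x > 0`. -/
def ExpGrowthLT (τ : ℝ) (f : ℂ → ℂ) : Prop :=
  ∃ α : ℝ, α < τ ∧ ∃ K : ℝ, 0 < K ∧
    ∀ x : ℂ, 0 < x.re → ‖f x‖ ≤ K * Real.exp (α * ‖x‖)

/-- `R` is the solution `R_a` of the difference equation `R x - R (x + 1) = a x` on the right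
half-plane: analytic there, of exponential growth of order less than `2π`, and normalised by
`∫_1^2 R = 0`. -/
structure IsRamanujanSolution (a R : ℂ → ℂ) : Prop where
  analytic : AnalyticOnNhd ℂ R {x : ℂ | 0 < x.re}
  growth : ExpGrowthLT (2 * Real.pi) R
  difference : ∀ x : ℂ, 0 < x.re → R x - R (x + 1) = a x
  normalised : ∫ t in (1 : ℝ)..2, R (t : ℂ) = 0

/-- `s` is a Ramanujan sum of `∑_{n ≥ 1} u n`: the terms `u n` (`n ≥ 1`) are the values of a function
`a` that is analytic and of exponential growth of order less than `π` on the right half-plane,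
and `s = R_a(1)`. -/
def HasRamanujanSum (u : ℕ → ℂ) (s : ℂ) : Prop :=
  ∃ a R : ℂ → ℂ, AnalyticOnNhd ℂ a {x : ℂ | 0 < x.re} ∧ ExpGrowthLT Real.pi a ∧
    (∀ n : ℕ, 1 ≤ n → a (n : ℂ) = u n) ∧ IsRamanujanSolution a R ∧ R 1 = s

/-- The Ramanujan sum of `∑_{n ≥ 1} u n` exists, is well defined (it does not depend on the
interpolating function nor on the solution of the difference equation), and equals `s`. -/
def RamanujanSumEq (u : ℕ → ℂ) (s : ℂ) : Prop :=
  HasRamanujanSum u s ∧ ∀ t : ℂ, HasRamanujanSum u t → t = s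

/-- The closed form for the Ramanujan sum of `∑_{n ≥ 1} e^{-nz} H_n` (meaningful for `z ≠ 0`).
`Complex.log` is the principal logarithm, `Complex.digamma` is `Γ' / Γ`. -/
noncomputable def harmonicExpClosedForm (z : ℂ) : ℂ :=
  1 / (1 - Complex.exp (-z)) * Complex.log (z / (1 - Complex.exp (-z)))
    + 1 / (1 - Complex.exp (-z)) *
        ∑' n : ℕ, (-1 : ℂ) ^ (n + 1) / ((n + 1 : ℕ) : ℂ) * (z ^ (n + 1) / ((n + 1).factorial : ℂ))
    + (Real.eulerMascheroniConstant : ℂ) * (1 / (1 - Complex.exp (-z)) - Complex.exp (-z) / z)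
    - 1 / (Complex.exp z - 1) *
        ∫ x in (0 : ℝ)..1, Complex.digamma ((x : ℂ) + 1) * Complex.exp (-z * (x : ℂ))

/-! Uniqueness. The difference of two interpolating functions has exponential type less than π and
vanishes at the positive integers, so Carlson's theorem (`eq_zero_of_vanish_at_nat`) makes it zero
on Re x > 1/2. The difference of two solutions is then 1-periodic there, of type less than 2π and of
mean zero on [1, 2]; shifting the contour up or down kills all its Fourier coefficients
(`eq_zero_of_periodic_of_growth`).

Existence for z ≠ 0. Let H(x) = ψ(x+1) + γ (`harmonicInterp`) and Λ_z(y) = -∫_0^z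
(e^{-yw}/(1-e^{-w}) - 1/w) dw (`lerchIntegral`). Then H(x+1) - H(x) = 1/(x+1) and Λ_z(y+1) - Λ_z(y)
= ∫_0^z e^{-yw} dw = (1-e^{-yz})/y, so by summation by parts R(x) = (e^{-xz} H(x) + γ - H(x) +
Λ_z(x+1)) / (1-e^{-z}) satisfies R(x) - R(x+1) = e^{-xz} H(x). The Ramanujan sum is R(1) - ∫_1^2 R,
and the closed form follows from Λ_z(1) = log(z/(1-e^{-z})), from ∫_1^2 Λ_z = ∫_0^z (1-e^{-u})/u du
and from ∫_0^1 ψ(x+1) dx = 0.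

At z = 0 the solution is x - x H(x), up to a constant; the resulting sum agrees with the limit of
the closed form, which is the derivative at 0 of its numerator over 1-e^{-z}. -/

/-! ### Phragmén–Lindelöf estimates in the right half-plane. -/

open Filter Set in
/-- An exponential bound in the form required by the Phragmén–Lindelöf principle. -/
lemma isBigO_exp_rpow_of_norm_le {S : Set ℂ} {f : ℂ → ℂ} {K B : ℝ}
    (h : ∀ z ∈ S, ‖f z‖ ≤ K * Real.exp (B * ‖z‖)) :
    ∃ c < (2 : ℝ), ∃ B, f =O[Bornology.cobounded ℂ ⊓ 𝓟 S] fun z => Real.exp (B * ‖z‖ ^ c) := by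
  refine ⟨1, by norm_num, B, Asymptotics.IsBigO.of_bound K ?_⟩
  refine eventually_inf_principal.2 (Eventually.of_forall fun z hz => ?_)
  simpa [abs_of_pos (Real.exp_pos _)] using h z hz

open Set in
lemma closure_quadrant_I_subset : closure (Ioi (0 : ℝ) ×ℂ Ioi (0 : ℝ)) ⊆ {z : ℂ | 0 ≤ z.re ∧ 0 ≤ z.im} := by
  rw [Complex.closure_reProdIm]
  simp only [closure_Ioi]
  intro z hz
  exact ⟨hz.1, hz.2⟩

open Set in
lemma closure_quadrant_IV_subset : closure (Ioi (0 : ℝ) ×ℂ Iio (0 : ℝ)) ⊆ {z : ℂ | 0 ≤ z.re ∧ z.im ≤ 0} := by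
  rw [Complex.closure_reProdIm]
  simp only [closure_Ioi, closure_Iio]
  intro z hz
  exact ⟨hz.1, hz.2⟩

/-- Multiplying by the exponential of a linear function preserves exponential bounds. -/
lemma norm_mul_exp_linear_le {K A : ℝ} {g e b w : ℂ}
    (hg : ‖g‖ ≤ K * Real.exp (A * ‖e‖)) (hA : 0 ≤ A) {M : ℝ} (he : ‖e‖ ≤ M * ‖w‖) (hK : 0 ≤ K) :
    ‖g * Complex.exp (b * w)‖ ≤ K * Real.exp ((A * M + ‖b‖) * ‖w‖) := by
  rw [norm_mul, Complex.norm_exp]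
  have h1 : (b * w).re ≤ ‖b‖ * ‖w‖ := (Complex.re_le_norm _).trans (norm_mul _ _).le
  have h2 : A * ‖e‖ ≤ A * (M * ‖w‖) := mul_le_mul_of_nonneg_left he hA
  calc ‖g‖ * Real.exp (b * w).re ≤ K * Real.exp (A * ‖e‖) * Real.exp (b * w).re := by gcongr
    _ = K * Real.exp (A * ‖e‖ + (b * w).re) := by rw [Real.exp_add]; ring
    _ ≤ _ := by gcongr; linarith

section HalfPlane

variable {g : ℂ → ℂ} {K A δ : ℝ}

/-- In each quadrant the factor exp((-τ ∓ iδ)z) has modulus e^{-τ Re z + δ|Im z|}, so its product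
with g is at most K on both edges, hence inside. -/
lemma norm_le_of_real_bound_of_imag_decay (hd : DifferentiableOn ℂ g {z | 0 ≤ z.re})
    (hK : 0 ≤ K) (hA : 0 ≤ A)
    (hg : ∀ z : ℂ, 0 ≤ z.re → ‖g z‖ ≤ K * Real.exp (A * ‖z‖))
    (him : ∀ y : ℝ, ‖g (y * Complex.I)‖ ≤ K * Real.exp (-δ * |y|)) {τ : ℝ}
    (hre : ∀ x : ℝ, 0 ≤ x → ‖g x‖ ≤ K * Real.exp (τ * x)) {z : ℂ} (hz : 0 ≤ z.re) :
    ‖g z‖ ≤ K * Real.exp (τ * z.re - δ * |z.im|) := by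
  have key : ∀ b : ℂ, ‖g z * Complex.exp (b * z)‖ ≤ K →
      ‖g z‖ ≤ K * Real.exp (-(b * z).re) := by
    intro b hb
    rw [norm_mul, Complex.norm_exp] at hb
    rw [Real.exp_neg, ← div_eq_mul_inv, le_div_iff₀ (Real.exp_pos _)]
    exact hb
  rcases le_total 0 z.im with hi | hi
  · have := key (-τ - Complex.I * δ) ?_
    · convert this using 3
      simp [abs_of_nonneg hi]
      ring
    refine PhragmenLindelof.quadrant_I (f := fun z => g z * Complex.exp ((-τ - Complex.I * δ) * z))
      ?_ ?_ ?_ ?_ hz hi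
    · refine DifferentiableOn.diffContOnCl ?_
      refine (hd.mono ?_).mul (by fun_prop)
      exact fun w hw => (closure_quadrant_I_subset hw).1
    · refine isBigO_exp_rpow_of_norm_le (K := K) (B := A * 1 + ‖(-τ - Complex.I * δ : ℂ)‖) fun w hw => ?_
      exact norm_mul_exp_linear_le (hg w (le_of_lt hw.1)) hA (M := 1) (by simp) hK
    · intro x hx
      rw [norm_mul, Complex.norm_exp]
      have : ((-τ - Complex.I * δ) * (x : ℂ)).re = - (τ * x) := by simp
      rw [this, Real.exp_neg, ← div_eq_mul_inv, div_le_iff₀ (Real.exp_pos _)]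
      exact hre x hx
    · intro x hx
      rw [norm_mul, Complex.norm_exp]
      have : ((-τ - Complex.I * δ) * ((x : ℂ) * Complex.I)).re = - (-δ * |x|) := by
        simp [abs_of_nonneg hx]
      rw [this, Real.exp_neg, ← div_eq_mul_inv, div_le_iff₀ (Real.exp_pos _)]
      exact him x
  · have := key (-τ + Complex.I * δ) ?_
    · convert this using 3
      simp [abs_of_nonpos hi]
      ring
    refine PhragmenLindelof.quadrant_IV (f := fun z => g z * Complex.exp ((-τ + Complex.I * δ) * z))
      ?_ ?_ ?_ ?_ hz hi
    · refine DifferentiableOn.diffContOnCl ?_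
      refine (hd.mono ?_).mul (by fun_prop)
      exact fun w hw => (closure_quadrant_IV_subset hw).1
    · refine isBigO_exp_rpow_of_norm_le (K := K) (B := A * 1 + ‖(-τ + Complex.I * δ : ℂ)‖) fun w hw => ?_
      exact norm_mul_exp_linear_le (hg w (le_of_lt hw.1)) hA (M := 1) (by simp) hK
    · intro x hx
      rw [norm_mul, Complex.norm_exp]
      have : ((-τ + Complex.I * δ) * (x : ℂ)).re = - (τ * x) := by simp
      rw [this, Real.exp_neg, ← div_eq_mul_inv, div_le_iff₀ (Real.exp_pos _)]
      exact hre x hx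
    · intro x hx
      rw [norm_mul, Complex.norm_exp]
      have : ((-τ + Complex.I * δ) * ((x : ℂ) * Complex.I)).re = - (-δ * |x|) := by
        simp [abs_of_nonpos hx]
      rw [this, Real.exp_neg, ← div_eq_mul_inv, div_le_iff₀ (Real.exp_pos _)]
      exact him x

/-- On the rays arg z = ±π/4, where |Im z| = Re z, the previous bound already reads K e^{(τ-δ) Re
z}; Phragmén–Lindelöf in the sector between them carries it to the real axis. The constant K is
unchanged, so the gain can be iterated. -/
lemma real_bound_improve (hd : DifferentiableOn ℂ g {z | 0 ≤ z.re})
    (hK : 0 ≤ K) (hA : 0 ≤ A)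
    (hg : ∀ z : ℂ, 0 ≤ z.re → ‖g z‖ ≤ K * Real.exp (A * ‖z‖))
    (him : ∀ y : ℝ, ‖g (y * Complex.I)‖ ≤ K * Real.exp (-δ * |y|)) {τ : ℝ}
    (hre : ∀ x : ℝ, 0 ≤ x → ‖g x‖ ≤ K * Real.exp (τ * x)) (x : ℝ) (hx : 0 ≤ x) :
    ‖g x‖ ≤ K * Real.exp ((τ - δ) * x) := by
  -- Multiplication by 1 - i maps the first quadrant onto the sector |arg| < π/4.
  set ω : ℂ := 1 - Complex.I with hω
  have hωre : ∀ w : ℂ, (ω * w).re = w.re + w.im := fun w => by simp [hω]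
  have hωim : ∀ w : ℂ, (ω * w).im = w.im - w.re := fun w => by simp [hω]; ring
  set h : ℂ → ℂ := fun w => g (ω * w) * Complex.exp (-(τ - δ) * ω * w) with hh
  have hexp : ∀ w : ℂ, ‖Complex.exp (-(τ - δ) * ω * w)‖ = (Real.exp ((τ - δ) * (w.re + w.im)))⁻¹ := by
    intro w
    rw [Complex.norm_exp, ← Real.exp_neg, mul_assoc]
    congr 1
    have : (-((τ : ℂ) - δ)) = ((-(τ - δ) : ℝ) : ℂ) := by push_cast; ring
    rw [this, Complex.re_ofReal_mul, hωre]
    ring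
  have hray : ∀ w : ℂ, 0 ≤ w.re + w.im → |w.im - w.re| = w.re + w.im → ‖h w‖ ≤ K := by
    intro w h0 h1
    have := norm_le_of_real_bound_of_imag_decay hd hK hA hg him hre (z := ω * w) (by rw [hωre]; exact h0)
    rw [hωre, hωim, h1] at this
    rw [hh]
    simp only
    rw [norm_mul, hexp, ← div_eq_mul_inv, div_le_iff₀ (Real.exp_pos _)]
    refine this.trans (le_of_eq ?_)
    ring_nf
  have main : ‖h ((x : ℂ) * (1 + Complex.I) / 2)‖ ≤ K := by
    have hr : ((x : ℂ) * (1 + Complex.I) / 2).re = x / 2 := by simp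
    have hi : ((x : ℂ) * (1 + Complex.I) / 2).im = x / 2 := by simp
    refine PhragmenLindelof.quadrant_I ?_ ?_ ?_ ?_ (by rw [hr]; positivity) (by rw [hi]; positivity)
    · refine DifferentiableOn.diffContOnCl ?_
      refine DifferentiableOn.mul ?_ (by fun_prop)
      refine hd.comp (by fun_prop) ?_
      intro w hw
      have := closure_quadrant_I_subset hw
      simp only [Set.mem_ofPred_eq] at this ⊢
      rw [hωre]
      linarith [this.1, this.2]
    · refine isBigO_exp_rpow_of_norm_le (K := K) (B := A * ‖ω‖ + ‖-((τ : ℂ) - δ) * ω‖) fun w hw => ?_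
      refine norm_mul_exp_linear_le (M := ‖ω‖) (hg _ ?_) hA (norm_mul _ _).le hK
      rw [hωre]
      exact add_nonneg (le_of_lt hw.1) (le_of_lt hw.2)
    · intro u hu
      exact hray _ (by simpa using hu) (by simpa using hu)
    · intro u hu
      exact hray _ (by simpa using hu) (by simpa using hu)
  have hx' : ω * ((x : ℂ) * (1 + Complex.I) / 2) = x := by
    have := Complex.I_sq
    linear_combination (-(x : ℂ) / 2) * this
  rw [hh] at main
  simp only at main
  rw [norm_mul, hexp, hx', ← div_eq_mul_inv, div_le_iff₀ (Real.exp_pos _)] at main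
  refine main.trans (le_of_eq ?_)
  congr 2
  simp

/-- A function of exponential type on the right half-plane that decays exponentially on the
imaginary axis vanishes. -/
lemma eq_zero_of_exp_type_of_imag_decay (hd : DifferentiableOn ℂ g {z | 0 ≤ z.re})
    (hA : 0 ≤ A) (hδ : 0 < δ)
    (hg : ∀ z : ℂ, 0 ≤ z.re → ‖g z‖ ≤ K * Real.exp (A * ‖z‖))
    (him : ∀ y : ℝ, ‖g (y * Complex.I)‖ ≤ K * Real.exp (-δ * |y|)) {z : ℂ} (hz : 0 < z.re) :
    g z = 0 := by
  have hK : 0 ≤ K := by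
    have := (norm_nonneg _).trans (hg 0 le_rfl)
    simpa using this
  -- Each application lowers the type on the real axis by δ; for fixed z with Re z > 0 the resulting
  -- bounds tend to 0.
  have hn : ∀ n : ℕ, ∀ x : ℝ, 0 ≤ x → ‖g x‖ ≤ K * Real.exp ((A - n * δ) * x) := by
    intro n
    induction n with
    | zero =>
      intro x hx
      simpa [abs_of_nonneg hx] using hg x (by simpa using hx)
    | succ n ih =>
      intro x hx
      have := real_bound_improve hd hK hA hg him ih x hx
      refine this.trans (le_of_eq ?_)
      push_cast
      ring_nf
  have hb : ∀ n : ℕ, ‖g z‖ ≤ K * Real.exp ((A - n * δ) * z.re - δ * |z.im|) := fun n =>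
    norm_le_of_real_bound_of_imag_decay hd hK hA hg him (hn n) hz.le
  have hlim : Filter.Tendsto (fun n : ℕ => K * Real.exp ((A - n * δ) * z.re - δ * |z.im|))
      Filter.atTop (nhds (K * 0)) := by
    refine Filter.Tendsto.const_mul _ (Real.tendsto_exp_atBot.comp ?_)
    have h1 : Filter.Tendsto (fun n : ℕ => (n : ℝ) * (δ * z.re)) Filter.atTop Filter.atTop :=
      tendsto_natCast_atTop_atTop.atTop_mul_const (by positivity)
    have h2 := Filter.tendsto_neg_atTop_atBot.comp h1
    have h3 := Filter.tendsto_atBot_add_const_right Filter.atTop (A * z.re - δ * |z.im|) h2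
    refine h3.congr fun n => ?_
    simp only [Function.comp]
    ring
  have := ge_of_tendsto' hlim hb
  rw [mul_zero] at this
  exact norm_le_zero_iff.1 this

end HalfPlane

/-! ### Carlson's theorem. -/

/-- Division by a function with simple zeros. -/
lemma exists_differentiableOn_mul_eq {U : Set ℂ} (hU : IsOpen U) {F c : ℂ → ℂ}
    (hF : DifferentiableOn ℂ F U) (hc : DifferentiableOn ℂ c U)
    (hc' : ∀ w ∈ U, c w = 0 → deriv c w ≠ 0) (h0 : ∀ w ∈ U, c w = 0 → F w = 0) :
    ∃ g : ℂ → ℂ, DifferentiableOn ℂ g U ∧ ∀ w ∈ U, F w = g w * c w := by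
  classical
  -- At a zero of c the quotient takes its l'Hôpital value; near it, it is the quotient of the two
  -- `dslope`s, which are holomorphic.
  refine ⟨fun w => if c w = 0 then deriv F w / deriv c w else F w / c w, ?_, ?_⟩
  · intro w hw
    refine DifferentiableAt.differentiableWithinAt ?_
    have hUw := hU.mem_nhds hw
    by_cases hcw : c w = 0
    · have hdF : DifferentiableAt ℂ (dslope F w) w :=
        ((Complex.differentiableOn_dslope hUw).2 hF).differentiableAt hUw
      have hdc : DifferentiableAt ℂ (dslope c w) w :=
        ((Complex.differentiableOn_dslope hUw).2 hc).differentiableAt hUw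
      have hne : dslope c w w ≠ 0 := by
        rw [dslope_same]; exact hc' w hw hcw
      have hev : ∀ᶠ v in nhds w, dslope c w v ≠ 0 := hdc.continuousAt.eventually_ne hne
      refine (hdF.div hdc hne).congr_of_eventuallyEq ?_
      filter_upwards [hev] with v hv
      by_cases hvw : v = w
      · subst hvw
        simp [hcw, dslope_same]
      · have hcv : c v ≠ 0 := by
          rw [dslope_of_ne _ hvw, slope_def_field, hcw, sub_zero] at hv
          exact (div_ne_zero_iff.1 hv).1
        rw [if_neg hcv, Pi.div_apply, dslope_of_ne _ hvw, dslope_of_ne _ hvw, slope_def_field, slope_def_field,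
          hcw, h0 w hw hcw, sub_zero, sub_zero, div_div_div_cancel_right₀ (sub_ne_zero.2 hvw)]
    · have hev : ∀ᶠ v in nhds w, c v ≠ 0 :=
        (hc.differentiableAt hUw).continuousAt.eventually_ne hcw
      refine ((hF.differentiableAt hUw).div (hc.differentiableAt hUw) hcw).congr_of_eventuallyEq ?_
      filter_upwards [hev] with v hv
      simp [hv]
  · intro w hw
    by_cases hcw : c w = 0
    · simp [hcw, h0 w hw hcw]
    · simp [hcw]

lemma Complex.norm_cos_sq (z : ℂ) :
    ‖Complex.cos z‖ ^ 2 = Real.cos z.re ^ 2 + Real.sinh z.im ^ 2 := by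
  rw [Complex.cos_eq, ← Complex.ofReal_cos, ← Complex.ofReal_cosh, ← Complex.ofReal_sin,
    ← Complex.ofReal_sinh, ← Complex.normSq_eq_norm_sq, Complex.normSq_apply]
  simp only [Complex.sub_re, Complex.sub_im, Complex.mul_re, Complex.mul_im, Complex.ofReal_re,
    Complex.ofReal_im, Complex.I_re, Complex.I_im]
  linear_combination Real.cos z.re ^ 2 * Real.cosh_sq z.im +
    Real.sinh z.im ^ 2 * Real.sin_sq_add_cos_sq z.re

lemma one_le_norm_cos_pi_mul_of_re_int {w : ℂ} {n : ℤ} (h : w.re = n) :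
    1 ≤ ‖Complex.cos (Real.pi * w)‖ := by
  have h1 := Complex.norm_cos_sq (Real.pi * w)
  rw [Complex.re_ofReal_mul, h, mul_comm Real.pi, Real.cos_int_mul_pi] at h1
  have h2 : ((-1 : ℝ) ^ n) ^ 2 = 1 := by
    rcases Int.even_or_odd n with h | h <;> simp [h.neg_one_zpow]
  rw [h2] at h1
  nlinarith [sq_nonneg (Real.sinh (Real.pi * w).im), norm_nonneg (Complex.cos (Real.pi * w))]

lemma one_le_norm_cos_pi_mul_of_one_le_abs_im {w : ℂ} (h : 1 ≤ |w.im|) :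
    1 ≤ ‖Complex.cos (Real.pi * w)‖ := by
  have h1 := Complex.norm_cos_sq (Real.pi * w)
  have h2 : 1 ≤ |Real.sinh (Real.pi * w.im)| := by
    rw [Real.abs_sinh, abs_mul, abs_of_pos Real.pi_pos]
    have : Real.pi * |w.im| ≤ Real.sinh (Real.pi * |w.im|) :=
      Real.self_le_sinh_iff.2 (by positivity)
    nlinarith [Real.pi_gt_three]
  rw [Complex.im_ofReal_mul] at h1
  have h3 : 1 ≤ Real.sinh (Real.pi * w.im) ^ 2 := by
    rw [← sq_abs]; nlinarith
  nlinarith [sq_nonneg (Real.cos (Real.pi * w : ℂ).re), norm_nonneg (Complex.cos (Real.pi * w))]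

lemma exp_div_two_le_norm_cos_imag (y : ℝ) :
    Real.exp (Real.pi * |y|) / 2 ≤ ‖Complex.cos (Real.pi * (y * Complex.I))‖ := by
  rw [← mul_assoc, ← Complex.ofReal_mul, Complex.cos_mul_I, ← Complex.ofReal_cosh,
    Complex.norm_real, Real.norm_of_nonneg (Real.cosh_pos _).le, ← Real.cosh_abs, abs_mul,
    abs_of_pos Real.pi_pos, Real.cosh_eq]
  have := Real.exp_pos (-(Real.pi * |y|))
  linarith

/-- **Carlson's theorem**: a function of exponential type less than `π` on the right half-plane
that vanishes at the positive integers vanishes. -/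
lemma eq_zero_of_vanish_at_nat {f : ℂ → ℂ} (hf : DifferentiableOn ℂ f {x : ℂ | 0 < x.re})
    (hg : ExpGrowthLT Real.pi f) (h0 : ∀ n : ℕ, 1 ≤ n → f n = 0) {x : ℂ} (hx : 1 / 2 < x.re) :
    f x = 0 := by
  obtain ⟨α', hα', K, hK, hb'⟩ := hg
  obtain ⟨α, hα0, hα, hb⟩ : ∃ α : ℝ, 0 ≤ α ∧ α < Real.pi ∧
      ∀ x : ℂ, 0 < x.re → ‖f x‖ ≤ K * Real.exp (α * ‖x‖) := by
    refine ⟨max α' 0, le_max_right _ _, max_lt hα' Real.pi_pos, fun x hx => (hb' x hx).trans ?_⟩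
    gcongr
    exact le_max_left _ _
  set U : Set ℂ := {w : ℂ | -(1 / 2) < w.re} with hU
  have hUo : IsOpen U := isOpen_lt continuous_const Complex.continuous_re
  -- Since cos πw = sin π(w + 1/2), f(x)/sin πx is taken with x = w + 1/2: the imaginary axis in w
  -- then lies inside the domain of f and halfway between zeros of the sine.
  obtain ⟨g, hgd, hgm⟩ := exists_differentiableOn_mul_eq hUo (F := fun w => f (w + 1 / 2))
    (c := fun w => Complex.cos (Real.pi * w))
    (by
      refine hf.comp (by fun_prop) fun w hw => ?_
      have : -(1 / 2) < w.re := hw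
      simp
      linarith)
    (by fun_prop)
    (by
      intro w _ hw
      have hd : HasDerivAt (fun w : ℂ => Complex.cos (Real.pi * w))
          (-Complex.sin (Real.pi * w) * Real.pi) w := by
        have h1 : HasDerivAt (fun w : ℂ => (Real.pi : ℂ) * w) Real.pi w := by
          simpa using (hasDerivAt_id w).const_mul (Real.pi : ℂ)
        exact (Complex.hasDerivAt_cos (Real.pi * w)).comp w h1
      rw [hd.deriv]
      have h1 := Complex.sin_sq_add_cos_sq (Real.pi * w)
      rw [hw] at h1
      refine mul_ne_zero (neg_ne_zero.2 fun h => ?_) (by exact_mod_cast Real.pi_ne_zero)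
      rw [h] at h1
      norm_num at h1)
    (by
      intro w hw hc
      obtain ⟨k, hk⟩ := Complex.cos_eq_zero_iff.1 hc
      have hpi : (Real.pi : ℂ) ≠ 0 := by exact_mod_cast Real.pi_ne_zero
      have hwk : w = k + 1 / 2 := by
        apply mul_left_cancel₀ hpi
        rw [hk]; ring
      have hk0 : 0 ≤ k := by
        have h2 : -(1 / 2) < w.re := hw
        rw [hwk] at h2
        simp at h2
        have h3 : (-1 : ℝ) < k := by linarith
        have : (-1 : ℤ) < k := by exact_mod_cast h3
        omega
      lift k to ℕ using hk0
      have := h0 (k + 1) (by omega)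
      rw [← this, hwk]
      congr 1
      push_cast
      ring)
  have hFb : ∀ w : ℂ, 0 ≤ w.re → 1 ≤ ‖Complex.cos (Real.pi * w)‖ →
      ‖g w‖ ≤ K * Real.exp (α * (‖w‖ + 1 / 2)) := by
    intro w hw hc
    have h1 := hgm w (show -(1 / 2) < w.re by linarith)
    have h2 := hb (w + 1 / 2) (by simp; linarith)
    rw [h1, norm_mul] at h2
    refine (le_mul_of_one_le_right (norm_nonneg _) hc).trans (h2.trans ?_)
    gcongr
    refine (norm_add_le _ _).trans ?_
    simp
  -- The bound in the half-plane and the one on the imaginary axis must share a constant: the 2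
  -- comes from cosh t ≥ e^t/2, and the 4 covers the distance 3 inside a cell plus the shift 1/2.
  have hgb : ∀ z : ℂ, 0 ≤ z.re → ‖g z‖ ≤ 2 * K * Real.exp (α * 4) * Real.exp (α * ‖z‖) := by
    intro z hz
    suffices h : ‖g z‖ ≤ K * Real.exp (α * (‖z‖ + 4)) by
      refine h.trans ?_
      rw [mul_assoc, ← Real.exp_add]
      have : α * (‖z‖ + 4) = α * 4 + α * ‖z‖ := by ring
      rw [this]
      nlinarith [Real.exp_pos (α * 4 + α * ‖z‖)]
    by_cases hi : 1 ≤ |z.im|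
    · refine (hFb z hz (one_le_norm_cos_pi_mul_of_one_le_abs_im hi)).trans ?_
      gcongr
      norm_num
    · push Not at hi
      -- Near the real axis the cosine may be small, so the maximum principle is applied on the cell
      -- [n, n+1] × [-1, 1], on whose boundary |cos πw| ≥ 1.
      set n : ℤ := ⌊z.re⌋ with hn
      have hn0 : 0 ≤ n := Int.floor_nonneg.2 hz
      have hn0' : (0 : ℝ) ≤ n := by exact_mod_cast hn0
      have hn1 := Int.floor_le z.re
      have hn2 := Int.lt_floor_add_one z.re
      rw [← hn] at hn1 hn2
      have hlt : (n : ℝ) ≠ n + 1 := by linarith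
      have hcl : closure (Set.Ioo (n : ℝ) (n + 1) ×ℂ Set.Ioo (-1 : ℝ) 1) =
          Set.Icc (n : ℝ) (n + 1) ×ℂ Set.Icc (-1 : ℝ) 1 := by
        rw [Complex.closure_reProdIm, closure_Ioo hlt, closure_Ioo (by norm_num)]
      refine Complex.norm_le_of_forall_mem_frontier_norm_le
        (U := Set.Ioo (n : ℝ) (n + 1) ×ℂ Set.Ioo (-1 : ℝ) 1) ?_ ?_ ?_ ?_
      · exact Metric.isBounded_Ioo _ _ |>.reProdIm (Metric.isBounded_Ioo _ _)
      · refine DifferentiableOn.diffContOnCl (hgd.mono ?_)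
        rw [hcl]
        intro w hw
        have := hw.1.1
        show -(1 / 2) < w.re
        linarith
      · intro w hw
        have hwc : w ∈ Set.Icc (n : ℝ) (n + 1) ×ℂ Set.Icc (-1 : ℝ) 1 := by
          rw [← hcl]; exact frontier_subset_closure hw
        have hw0 : 0 ≤ w.re := hn0'.trans hwc.1.1
        have hc : 1 ≤ ‖Complex.cos (Real.pi * w)‖ := by
          rw [Complex.frontier_reProdIm, frontier_Ioo (by linarith), frontier_Ioo (by norm_num)] at hw
          rcases hw with hw | hw
          · refine one_le_norm_cos_pi_mul_of_one_le_abs_im ?_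
            have h3 : w.im = -1 ∨ w.im = 1 := hw.2
            rcases h3 with h3 | h3 <;> simp [h3]
          · have h3 : w.re = n ∨ w.re = n + 1 := hw.1
            rcases h3 with h3 | h3
            · exact one_le_norm_cos_pi_mul_of_re_int h3
            · exact one_le_norm_cos_pi_mul_of_re_int (n := n + 1) (by push_cast; exact h3)
        refine (hFb w hw0 hc).trans ?_
        have hd : ‖w‖ ≤ ‖z‖ + 3 := by
          have h4 : ‖w - z‖ ≤ 3 := by
            refine (Complex.norm_le_abs_re_add_abs_im _).trans ?_
            have h5 : |(w - z).re| ≤ 1 := by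
              rw [Complex.sub_re, abs_le]; constructor <;> linarith [hwc.1.1, hwc.1.2]
            have h6 : |(w - z).im| ≤ 2 := by
              have := abs_lt.1 hi
              rw [Complex.sub_im, abs_le]; constructor <;> linarith [hwc.2.1, hwc.2.2]
            linarith
          have := norm_add_le (w - z) z
          rw [sub_add_cancel] at this
          linarith
        gcongr ?_ * Real.exp (?_ * ?_)
        linarith
      · rw [hcl]
        have := abs_lt.1 hi
        exact ⟨⟨hn1, hn2.le⟩, ⟨this.1.le, this.2.le⟩⟩
  have hgi : ∀ y : ℝ, ‖g (y * Complex.I)‖ ≤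
      2 * K * Real.exp (α * 4) * Real.exp (-(Real.pi - α) * |y|) := by
    intro y
    have h1 := hgm (y * Complex.I) (show -(1 / 2) < ((y : ℂ) * Complex.I).re by simp)
    have h2 := hb (y * Complex.I + 1 / 2) (by simp)
    have h3 : ‖(y * Complex.I + 1 / 2 : ℂ)‖ ≤ |y| + 4 := by
      refine (norm_add_le _ _).trans ?_
      simp
      norm_num
    rw [h1, norm_mul] at h2
    have h4 : ‖g (y * Complex.I)‖ * (Real.exp (Real.pi * |y|) / 2) ≤
        K * Real.exp (α * (|y| + 4)) :=
      (mul_le_mul_of_nonneg_left (exp_div_two_le_norm_cos_imag y) (norm_nonneg _)).trans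
        (h2.trans (by gcongr))
    have h5 : Real.exp (-(Real.pi - α) * |y|) = Real.exp (α * |y|) / Real.exp (Real.pi * |y|) := by
      rw [← Real.exp_sub]; congr 1; ring
    have h6 : Real.exp (α * (|y| + 4)) = Real.exp (α * |y|) * Real.exp (α * 4) := by
      rw [← Real.exp_add]; congr 1; ring
    rw [h6] at h4
    rw [h5, ← mul_div_assoc, le_div_iff₀ (Real.exp_pos _)]
    linarith
  have hz := eq_zero_of_exp_type_of_imag_decay (z := x - 1 / 2)
    (hgd.mono (fun w hw => by
      have : 0 ≤ w.re := hw
      show -(1 / 2) < w.re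
      linarith)) hα0 (sub_pos.2 hα) hgb hgi (by simp; linarith)
  have := hgm (x - 1 / 2) (show -(1 / 2) < (x - 1 / 2).re by simp; linarith)
  rw [hz, zero_mul, sub_add_cancel] at this
  exact this

/-! ### Periodic functions of small exponential type. -/

/-- In Cauchy's theorem for the rectangle the two vertical sides cancel. -/
lemma integral_rect_periodic {h : ℂ → ℂ} (hd : DifferentiableOn ℂ h {x : ℂ | 0 < x.re})
    (hp : ∀ y : ℝ, h (2 + y * Complex.I) = h (1 + y * Complex.I)) (Y : ℝ) :
    ∫ x in (1 : ℝ)..2, h x = ∫ x in (1 : ℝ)..2, h (x + Y * Complex.I) := by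
  have := Complex.integral_boundary_rect_eq_zero_of_differentiableOn h 1 (2 + Y * Complex.I)
    (hd.mono fun w hw => by
      have h1 := hw.1
      simp at h1
      have := h1.1
      show 0 < w.re
      linarith)
  simp [hp] at this
  exact sub_eq_zero.1 this

open Filter in
/-- A 1-periodic function of exponential type less than `2π` whose mean vanishes is zero. -/
lemma eq_zero_of_periodic_of_growth {D : ℂ → ℂ} (hd : DifferentiableOn ℂ D {x : ℂ | 0 < x.re})
    (hg : ExpGrowthLT (2 * Real.pi) D) (hp : ∀ x : ℂ, 1 / 2 < x.re → D (x + 1) = D x)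
    (hi : ∫ t in (1 : ℝ)..2, D t = 0) : D 1 = 0 := by
  obtain ⟨β', hβ', L, hL, hb'⟩ := hg
  obtain ⟨β, hβ0, hβ, hb⟩ : ∃ β : ℝ, 0 ≤ β ∧ β < 2 * Real.pi ∧
      ∀ x : ℂ, 0 < x.re → ‖D x‖ ≤ L * Real.exp (β * ‖x‖) := by
    refine ⟨max β' 0, le_max_right _ _, max_lt hβ' Real.two_pi_pos, fun x hx => (hb' x hx).trans ?_⟩
    gcongr
    exact le_max_left _ _
  have hcoef : ∀ n : ℤ,
      ∫ x in (1 : ℝ)..2, Complex.exp (2 * Real.pi * Complex.I * n * x) * D x = 0 := by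
    intro n
    rcases eq_or_ne n 0 with rfl | hn
    · simpa using hi
    set h : ℂ → ℂ := fun x => Complex.exp (2 * Real.pi * Complex.I * n * x) * D x with hh
    have hrect := integral_rect_periodic (h := h) (by fun_prop) (by
      intro y
      have h1 := hp (1 + y * Complex.I) (by simp; norm_num)
      have h2 : (1 + y * Complex.I + 1 : ℂ) = 2 + y * Complex.I := by ring
      rw [h2] at h1
      rw [hh]
      simp only
      rw [h1, Complex.exp_eq_exp_iff_exists_int.2]
      refine ⟨n, ?_⟩
      ring)
    have habs : 1 ≤ |(n : ℝ)| := by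
      have : 1 ≤ |n| := Int.one_le_abs hn
      exact_mod_cast this
    have hbound : ∀ t : ℝ, 0 ≤ t →
        ‖∫ x in (1 : ℝ)..2, h x‖ ≤ L * Real.exp (β * 2 - (2 * Real.pi - β) * t) := by
      intro t ht
      -- The contour moves up for n > 0 and down for n < 0, so that |e^{2πinx}| = e^{-2π|n|t} beats
      -- e^{βt}.
      set Y : ℝ := (SignType.sign n : ℤ) * t with hY
      have hnY : n * Y = |(n : ℝ)| * t := by
        rw [hY, ← mul_assoc]
        congr 1
        have := self_mul_sign n
        have h3 : ((n * (SignType.sign n : ℤ) : ℤ) : ℝ) = ((|n| : ℤ) : ℝ) := by rw [this]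
        push_cast at h3 ⊢
        exact h3
      have hYabs : |Y| = t := by
        have h4 : |(n : ℝ)| * |Y| = |(n : ℝ)| * t := by
          rw [← abs_mul, hnY, abs_mul, abs_abs, abs_of_nonneg ht]
        exact mul_left_cancel₀ (by linarith) h4
      rw [hrect Y]
      have := intervalIntegral.norm_integral_le_of_norm_le_const (a := (1 : ℝ)) (b := 2)
        (f := fun x : ℝ => h (x + Y * Complex.I))
        (C := L * Real.exp (β * 2 - (2 * Real.pi - β) * t)) (by
          intro x hx
          rw [Set.uIoc_of_le (by norm_num)] at hx
          rw [hh]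
          simp only
          rw [norm_mul, Complex.norm_exp]
          have h5 := hb (x + Y * Complex.I) (by simp; linarith [hx.1])
          have h6 : ‖(x + Y * Complex.I : ℂ)‖ ≤ 2 + t := by
            refine (norm_add_le _ _).trans ?_
            rw [norm_mul, Complex.norm_I, mul_one, Complex.norm_real, Complex.norm_real,
              Real.norm_eq_abs, Real.norm_eq_abs, hYabs, abs_of_nonneg (by linarith [hx.1])]
            linarith [hx.2]
          have h7 : (2 * Real.pi * Complex.I * n * (x + Y * Complex.I)).re = -(2 * Real.pi * (n * Y)) := by
            simp
            ring
          rw [h7, hnY]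
          calc _ ≤ Real.exp (-(2 * Real.pi * (|(n : ℝ)| * t))) * (L * Real.exp (β * (2 + t))) := by
                gcongr
                exact h5.trans (by gcongr)
            _ = L * Real.exp (-(2 * Real.pi * (|(n : ℝ)| * t)) + β * (2 + t)) := by
                rw [Real.exp_add]; ring
            _ ≤ _ := by
                gcongr
                have : 2 * Real.pi * (1 * t) ≤ 2 * Real.pi * (|(n : ℝ)| * t) := by gcongr
                linarith)
      refine this.trans (le_of_eq ?_)
      norm_num
    have hlim : Tendsto (fun t : ℝ => L * Real.exp (β * 2 - (2 * Real.pi - β) * t)) atTop (nhds (L * 0)) := by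
      refine Tendsto.const_mul _ (Real.tendsto_exp_atBot.comp ?_)
      have h1 : Tendsto (fun t : ℝ => (2 * Real.pi - β) * t) atTop atTop :=
        tendsto_id.const_mul_atTop (by linarith)
      have h2 := tendsto_atBot_add_const_left atTop (β * 2) (tendsto_neg_atTop_atBot.comp h1)
      exact h2.congr fun t => by simp [sub_eq_add_neg]
    have := ge_of_tendsto hlim ((eventually_ge_atTop 0).mono hbound)
    rw [mul_zero] at this
    exact norm_le_zero_iff.1 this
  have : Fact ((0 : ℝ) < 1) := ⟨one_pos⟩
  have hcont : Continuous (AddCircle.liftIco (1 : ℝ) 1 (fun t : ℝ => D t)) := by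
    refine AddCircle.liftIco_continuous ?_ ?_
    · have := hp 1 (by norm_num)
      norm_num at this ⊢
      exact this.symm
    · refine hd.continuousOn.comp Complex.continuous_ofReal.continuousOn fun t ht => ?_
      have := ht.1
      simp
      linarith
  set f : C(AddCircle (1 : ℝ), ℂ) := ⟨_, hcont⟩ with hf
  have hc0 : fourierCoeff f = 0 := by
    funext n
    rw [hf, ContinuousMap.coe_mk, fourierCoeff_liftIco_eq, fourierCoeffOn_eq_integral, Pi.zero_apply]
    have h1 : (1 : ℝ) + 1 = 2 := by norm_num
    rw [h1]
    convert smul_zero _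
    rw [← hcoef (-n)]
    congr 1
    funext x
    rw [fourier_coe_apply, smul_eq_mul]
    congr 2
    norm_num
  have hs := hasSum_fourier_series_of_summable (f := f) (by rw [hc0]; exact summable_zero)
  rw [hc0] at hs
  simp only [Pi.zero_apply, zero_smul] at hs
  have hf0 : f = 0 := hs.unique hasSum_zero
  have := AddCircle.liftIco_coe_apply (p := (1 : ℝ)) (a := 1) (f := fun t : ℝ => D t) (x := 1)
    ⟨le_rfl, by norm_num⟩
  have h2 : f ((1 : ℝ) : AddCircle (1 : ℝ)) = D ((1 : ℝ) : ℂ) := this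
  rw [hf0] at h2
  simpa using h2.symm

/-! ### Uniqueness of the Ramanujan sum. -/

lemma ExpGrowthLT.sub {τ : ℝ} {f g : ℂ → ℂ} (hf : ExpGrowthLT τ f) (hg : ExpGrowthLT τ g) :
    ExpGrowthLT τ (fun x => f x - g x) := by
  obtain ⟨α, hα, K, hK, hb⟩ := hf
  obtain ⟨β, hβ, L, hL, hc⟩ := hg
  refine ⟨max α β, max_lt hα hβ, K + L, by positivity, fun x hx => ?_⟩
  refine (norm_sub_le _ _).trans ?_
  rw [add_mul]
  refine add_le_add ((hb x hx).trans ?_) ((hc x hx).trans ?_)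
  · gcongr; exact le_max_left _ _
  · gcongr; exact le_max_right _ _

lemma continuousOn_ofReal_of_analyticOnNhd {R : ℂ → ℂ}
    (hR : AnalyticOnNhd ℂ R {x : ℂ | 0 < x.re}) :
    ContinuousOn (fun t : ℝ => R t) (Set.Ioi 0) :=
  hR.continuousOn.comp Complex.continuous_ofReal.continuousOn fun t ht => by simpa using ht

/-- The Ramanujan sum is well defined. -/
lemma HasRamanujanSum.unique {u : ℕ → ℂ} {s t : ℂ} (hs : HasRamanujanSum u s)
    (ht : HasRamanujanSum u t) : s = t := by
  obtain ⟨a, R, ha, hag, hau, hR, rfl⟩ := hs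
  obtain ⟨b, S, hb', hbg, hbu, hS, rfl⟩ := ht
  -- The strip 0 < Re x ≤ 1/2 can be left out: `eq_zero_of_periodic_of_growth` asks for periodicity
  -- only on Re x > 1/2.
  have hab : ∀ x : ℂ, 1 / 2 < x.re → a x - b x = 0 := fun x hx =>
    eq_zero_of_vanish_at_nat (f := fun x => a x - b x)
      (ha.differentiableOn.sub hb'.differentiableOn) (hag.sub hbg)
      (fun n hn => by rw [hau n hn, hbu n hn, sub_self]) hx
  have hint : ∀ {R : ℂ → ℂ}, AnalyticOnNhd ℂ R {x : ℂ | 0 < x.re} →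
      IntervalIntegrable (fun t : ℝ => R t) MeasureTheory.volume 1 2 := fun hR => by
    refine ContinuousOn.intervalIntegrable ((continuousOn_ofReal_of_analyticOnNhd hR).mono ?_)
    rw [Set.uIcc_of_le (by norm_num)]
    exact fun t ht => lt_of_lt_of_le one_pos ht.1
  have := eq_zero_of_periodic_of_growth (D := fun x => R x - S x)
    (hR.analytic.differentiableOn.sub hS.analytic.differentiableOn) (hR.growth.sub hS.growth)
    (fun x hx => by
      have h1 := hR.difference x (by linarith)
      have h2 := hS.difference x (by linarith)
      have h3 := hab x hx
      linear_combination h2 - h1 - h3)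
    (by
      rw [intervalIntegral.integral_sub (hint hR.analytic) (hint hS.analytic), hR.normalised,
        hS.normalised, sub_zero])
  exact sub_eq_zero.1 this

/-! ### Analytic interpolation of the harmonic numbers. -/

/-- The analytic interpolation `x ↦ ∑ₙ (1/(n+1) - 1/(n+1+x))` of the harmonic numbers. -/
noncomputable def harmonicInterp (x : ℂ) : ℂ :=
  ∑' n : ℕ, x / (((n : ℂ) + 1) * ((n : ℂ) + 1 + x))

namespace harmonicInterp

/-- The half-plane Re x > -1/2 stays away from the poles -1, -2, ... and contains 0, an endpoint of
the later integrals over [0, 1]. -/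
lemma half_le_norm {x : ℂ} (hx : -(1 / 2) < x.re) (n : ℕ) :
    ((n : ℝ) + 1) / 2 ≤ ‖(n : ℂ) + 1 + x‖ := by
  refine le_trans ?_ (Complex.re_le_norm _)
  have : (0 : ℝ) ≤ n := n.cast_nonneg
  simp
  linarith

lemma ne_zero {x : ℂ} (hx : -(1 / 2) < x.re) (n : ℕ) : (n : ℂ) + 1 + x ≠ 0 := by
  have h := half_le_norm hx n
  intro h0
  rw [h0, norm_zero] at h
  have : (0 : ℝ) ≤ n := n.cast_nonneg
  linarith

lemma norm_term_le {x : ℂ} (hx : -(1 / 2) < x.re) (n : ℕ) :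
    ‖x / (((n : ℂ) + 1) * ((n : ℂ) + 1 + x))‖ ≤ ‖x‖ * (2 * (1 / ((n : ℝ) + 1) ^ 2)) := by
  have h := half_le_norm hx n
  have hn : (0 : ℝ) < (n : ℝ) + 1 := by positivity
  have hn' : ‖(n : ℂ) + 1‖ = (n : ℝ) + 1 := by
    rw [← Nat.cast_succ, Complex.norm_natCast, Nat.cast_succ]
  rw [norm_div, norm_mul, hn', div_eq_mul_inv]
  refine mul_le_mul_of_nonneg_left ?_ (norm_nonneg _)
  have : ((n : ℝ) + 1) * (((n : ℝ) + 1) / 2) ≤ ((n : ℝ) + 1) * ‖(n : ℂ) + 1 + x‖ := by gcongr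
  refine (inv_anti₀ (by positivity) this).trans (le_of_eq ?_)
  field_simp

lemma summable_bound : Summable fun n : ℕ => 2 * (1 / ((n : ℝ) + 1) ^ 2) := by
  refine Summable.mul_left _ ?_
  have := (summable_nat_add_iff 1).2 (Real.summable_one_div_nat_pow.2 one_lt_two)
  simpa using this

lemma summable {x : ℂ} (hx : -(1 / 2) < x.re) :
    Summable fun n : ℕ => x / (((n : ℂ) + 1) * ((n : ℂ) + 1 + x)) :=
  Summable.of_norm_bounded (summable_bound.mul_left ‖x‖) (norm_term_le hx)

lemma norm_le {x : ℂ} (hx : -(1 / 2) < x.re) :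
    ‖harmonicInterp x‖ ≤ ‖x‖ * ∑' n : ℕ, 2 * (1 / ((n : ℝ) + 1) ^ 2) := by
  rw [← tsum_mul_left]
  exact tsum_of_norm_bounded (summable_bound.mul_left ‖x‖).hasSum (norm_term_le hx)

lemma differentiableOn : DifferentiableOn ℂ harmonicInterp {x : ℂ | -(1 / 2) < x.re} := by
  intro x hx
  set U : Set ℂ := {x : ℂ | -(1 / 2) < x.re} ∩ Metric.ball 0 (‖x‖ + 1) with hU
  have hUo : IsOpen U := (isOpen_lt continuous_const Complex.continuous_re).inter Metric.isOpen_ball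
  have hd : DifferentiableOn ℂ harmonicInterp U := by
    refine Complex.differentiableOn_tsum_of_summable_norm
      (summable_bound.mul_left (‖x‖ + 1)) (fun n => ?_) hUo (fun n w hw => ?_)
    · intro w hw
      refine DifferentiableAt.differentiableWithinAt ?_
      have h1 := ne_zero hw.1 n
      have h2 : (n : ℂ) + 1 ≠ 0 := by exact_mod_cast n.succ_ne_zero
      exact differentiableAt_id.div (by fun_prop) (mul_ne_zero h2 h1)
    · refine (norm_term_le hw.1 n).trans ?_
      have : ‖w‖ < ‖x‖ + 1 := by simpa using hw.2
      gcongr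
  exact (hd.differentiableAt (hUo.mem_nhds ⟨hx, by simp⟩)).differentiableWithinAt

lemma term_eq {x : ℂ} (hx : -(1 / 2) < x.re) (n : ℕ) :
    x / (((n : ℂ) + 1) * ((n : ℂ) + 1 + x)) = 1 / ((n : ℂ) + 1) - 1 / ((n : ℂ) + 1 + x) := by
  have h1 := ne_zero hx n
  have h2 : (n : ℂ) + 1 ≠ 0 := by exact_mod_cast n.succ_ne_zero
  field_simp
  ring

lemma map_zero : harmonicInterp 0 = 0 := by simp [harmonicInterp]

-- The difference of the two series telescopes.
open Filter in
lemma map_add_one {x : ℂ} (hx : -(1 / 2) < x.re) :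
    harmonicInterp (x + 1) = harmonicInterp x + 1 / (x + 1) := by
  have hx' : -(1 / 2) < (x + 1).re := by simp; linarith
  have h1 := (summable hx').hasSum.sub (summable hx).hasSum
  have h2 := h1.tendsto_sum_nat
  have h3 : ∀ N : ℕ, ∑ i ∈ Finset.range N, ((x + 1) / (((i : ℂ) + 1) * ((i : ℂ) + 1 + (x + 1))) -
      x / (((i : ℂ) + 1) * ((i : ℂ) + 1 + x))) = 1 / (x + 1) - 1 / ((N : ℂ) + 1 + x) := by
    intro N
    have : 1 / (x + 1) - 1 / ((N : ℂ) + 1 + x) =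
        1 / (((0 : ℕ) : ℂ) + 1 + x) - 1 / ((N : ℂ) + 1 + x) := by
      congr 2; push_cast; ring
    rw [this, ← Finset.sum_range_sub' (fun i : ℕ => 1 / ((i : ℂ) + 1 + x))]
    refine Finset.sum_congr rfl fun i _ => ?_
    rw [term_eq hx', term_eq hx]
    push_cast
    ring
  simp_rw [h3] at h2
  have h4 : Tendsto (fun N : ℕ => 1 / (x + 1) - 1 / ((N : ℂ) + 1 + x)) atTop
      (nhds (1 / (x + 1) - 0)) := by
    refine Tendsto.sub tendsto_const_nhds ?_
    simp_rw [one_div, add_assoc]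
    refine tendsto_inv₀_cobounded.comp ?_
    rw [← tendsto_norm_atTop_iff_cobounded]
    refine tendsto_atTop_mono (fun n => ?_) (tendsto_atTop_add_const_right atTop (-‖1 + x‖)
      tendsto_natCast_atTop_atTop)
    have := norm_sub_norm_le (n : ℂ) (-(1 + x))
    rw [norm_neg, sub_neg_eq_add, Complex.norm_natCast] at this
    linarith
  have h5 := tendsto_nhds_unique h2 h4
  rw [sub_zero] at h5
  have h6 : harmonicInterp (x + 1) - harmonicInterp x = 1 / (x + 1) := h5
  linear_combination h6

lemma map_natCast (n : ℕ) : harmonicInterp n = ((harmonic n : ℚ) : ℂ) := by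
  induction n with
  | zero => simp [map_zero]
  | succ n ih =>
    have : (0 : ℝ) ≤ n := n.cast_nonneg
    rw [Nat.cast_succ, map_add_one (by simp; linarith), ih, harmonic_succ]
    push_cast
    rw [one_div]

end harmonicInterp

/-! ### The digamma function on the positive reals. -/

section Digamma

lemma Real.differentiableAt_log_Gamma {x : ℝ} (hx : 0 < x) :
    DifferentiableAt ℝ (Real.log ∘ Real.Gamma) x := by
  refine (Real.differentiableAt_Gamma ?_).log (Real.Gamma_ne_zero ?_) <;>
  exact fun m => ne_of_gt (by have : (0 : ℝ) ≤ m := m.cast_nonneg; linarith)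

lemma Real.deriv_log_Gamma_add_one {x : ℝ} (hx : 0 < x) :
    deriv (Real.log ∘ Real.Gamma) (x + 1) = deriv (Real.log ∘ Real.Gamma) x + 1 / x := by
  rw [← deriv_comp_add_const, one_div, ← Real.deriv_log,
    ← deriv_add (Real.differentiableAt_log_Gamma hx) (Real.differentiableAt_log hx.ne')]
  apply Filter.EventuallyEq.deriv_eq
  filter_upwards [eventually_gt_nhds hx] with y hy
  simp only [Function.comp_apply, Pi.add_apply]
  rw [Real.Gamma_add_one hy.ne', Real.log_mul hy.ne' (Real.Gamma_pos_of_pos hy).ne', add_comm]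

lemma Complex.digamma_ofReal {x : ℝ} (hx : 0 < x) :
    Complex.digamma x = ((deriv (Real.log ∘ Real.Gamma) x : ℝ) : ℂ) := by
  have hm : ∀ m : ℕ, x ≠ -m := fun m => ne_of_gt (by
    have : (0 : ℝ) ≤ m := m.cast_nonneg
    linarith)
  have hg := (Real.differentiableAt_Gamma hm).hasDerivAt
  have hf : HasDerivAt Complex.Gamma (deriv Complex.Gamma x) x :=
    (Complex.differentiableAt_Gamma _ fun m => by exact_mod_cast hm m).hasDerivAt
  have h1 := hf.comp_ofReal
  have h2 := hg.ofReal_comp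
  simp_rw [Complex.Gamma_ofReal] at h1
  have h3 := h1.unique h2
  rw [Complex.digamma_def, logDeriv_apply, h3, Complex.Gamma_ofReal, Function.comp_def,
    deriv.log (Real.differentiableAt_Gamma hm) (Real.Gamma_pos_of_pos hx).ne']
  push_cast
  rfl

lemma Real.deriv_log_Gamma_one :
    deriv (Real.log ∘ Real.Gamma) 1 = -Real.eulerMascheroniConstant := by
  have := Complex.digamma_ofReal one_pos
  rw [Complex.ofReal_one, Complex.digamma_one] at this
  exact_mod_cast this.symm

-- With p = (log Γ)', the recurrence p(x+1) = p(x) + 1/x shows that the partial sum misses its limit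
-- by p(N+1+x) - p(N+1). As log Γ is convex, p is monotone, so this lies between 0 and p(N+2) -
-- p(N+1) = 1/(N+1).
open Filter in
lemma Real.tendsto_sum_deriv_log_Gamma {x : ℝ} (h0 : 0 ≤ x) (h1 : x ≤ 1) :
    Tendsto (fun N : ℕ => ∑ k ∈ Finset.range N, (1 / ((k : ℝ) + 1) - 1 / ((k : ℝ) + 1 + x))) atTop
      (nhds (deriv (Real.log ∘ Real.Gamma) (x + 1) + Real.eulerMascheroniConstant)) := by
  set p := deriv (Real.log ∘ Real.Gamma) with hp
  have hshift : ∀ (y : ℝ), 0 ≤ y → ∀ N : ℕ,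
      p (N + 1 + y) = p (y + 1) + ∑ k ∈ Finset.range N, 1 / ((k : ℝ) + 1 + y) := by
    intro y hy N
    induction N with
    | zero => simp [add_comm]
    | succ N ih =>
      rw [Finset.sum_range_succ, ← add_assoc, ← ih, ← Real.deriv_log_Gamma_add_one (by positivity)]
      congr 1
      push_cast
      ring
  have hmono : MonotoneOn p (Set.Ioi 0) :=
    Real.convexOn_log_Gamma.monotoneOn_deriv fun x hx => Real.differentiableAt_log_Gamma hx
  have hsum : ∀ N : ℕ, ∑ k ∈ Finset.range N, (1 / ((k : ℝ) + 1) - 1 / ((k : ℝ) + 1 + x)) =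
      p (x + 1) + Real.eulerMascheroniConstant - (p (N + 1 + x) - p (N + 1)) := by
    intro N
    have h2 := hshift x h0 N
    have h3 := hshift 0 le_rfl N
    simp only [add_zero, zero_add] at h3
    rw [hp, Real.deriv_log_Gamma_one, ← hp] at h3
    rw [Finset.sum_sub_distrib]
    linarith
  simp_rw [hsum]
  have hz : Tendsto (fun N : ℕ => p (N + 1 + x) - p (N + 1)) atTop (nhds 0) := by
    refine squeeze_zero (fun N => ?_) (fun N => ?_) tendsto_one_div_add_atTop_nhds_zero_nat
    · have hN : (0 : ℝ) < N + 1 := by positivity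
      exact sub_nonneg.2 (hmono hN (show (0 : ℝ) < N + 1 + x by positivity) (by linarith))
    · have hN : (0 : ℝ) < N + 1 := by positivity
      have h4 : p (N + 1 + x) ≤ p (N + 1 + 1) :=
        hmono (show (0 : ℝ) < N + 1 + x by positivity) (show (0 : ℝ) < N + 1 + 1 by positivity)
          (by linarith)
      rw [hp, Real.deriv_log_Gamma_add_one hN, ← hp] at h4
      linarith
  simpa using tendsto_const_nhds.sub hz

open Filter in
lemma Complex.digamma_add_one_eq_harmonicInterp {x : ℝ} (h0 : 0 ≤ x) (h1 : x ≤ 1) :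
    Complex.digamma ((x : ℂ) + 1) = harmonicInterp x - Real.eulerMascheroniConstant := by
  have hx : -(1 / 2) < (x : ℂ).re := by simp; linarith
  have h2 := (harmonicInterp.summable hx).hasSum.tendsto_sum_nat
  have h3 := (Complex.continuous_ofReal.tendsto _).comp (Real.tendsto_sum_deriv_log_Gamma h0 h1)
  have h4 := tendsto_nhds_unique (h2.congr fun N => ?_) h3
  · have h5 := Complex.digamma_ofReal (show 0 < x + 1 by linarith)
    push_cast at h4 h5
    rw [h5]
    have h6 : harmonicInterp x = _ := h4
    rw [h6]
    ring
  · simp only [Function.comp]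
    push_cast
    exact Finset.sum_congr rfl fun n _ => harmonicInterp.term_eq hx n

lemma continuousOn_harmonicInterp_ofReal {s : Set ℝ} (hs : s ⊆ Set.Ici 0) :
    ContinuousOn (fun x : ℝ => harmonicInterp x) s :=
  harmonicInterp.differentiableOn.continuousOn.comp Complex.continuous_ofReal.continuousOn
    fun x hx => by
      have : (0 : ℝ) ≤ x := hs hx
      show -(1 / 2) < (x : ℂ).re
      simp
      linarith

/-- The integrand minus γ is ψ(x+1), with antiderivative log Γ(x+1), which vanishes at 0 and 1. -/
lemma integral_harmonicInterp :
    ∫ x in (0 : ℝ)..1, harmonicInterp x = Real.eulerMascheroniConstant := by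
  have hc : IntervalIntegrable (fun x : ℝ => harmonicInterp x) MeasureTheory.volume 0 1 := by
    refine ContinuousOn.intervalIntegrable (continuousOn_harmonicInterp_ofReal ?_)
    rw [Set.uIcc_of_le zero_le_one]
    exact fun x hx => hx.1
  have h := intervalIntegral.integral_eq_sub_of_hasDerivAt (a := 0) (b := 1)
    (f := fun x : ℝ => ((Real.log (Real.Gamma (x + 1)) : ℝ) : ℂ))
    (f' := fun x : ℝ => harmonicInterp x - Real.eulerMascheroniConstant) (fun x hx => by
      rw [Set.uIcc_of_le zero_le_one] at hx
      have h0 := hx.1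
      rw [← Complex.digamma_add_one_eq_harmonicInterp hx.1 hx.2]
      have h2 := Complex.digamma_ofReal (show 0 < x + 1 by linarith)
      push_cast at h2
      rw [h2]
      exact ((Real.differentiableAt_log_Gamma
        (show 0 < x + 1 by linarith)).hasDerivAt.comp_add_const x 1).ofReal_comp)
    (hc.sub intervalIntegrable_const)
  rw [intervalIntegral.integral_sub hc intervalIntegrable_const] at h
  have h2 : (1 : ℝ) + 1 = 2 := by norm_num
  simp [h2] at h
  exact sub_eq_zero.1 h

end Digamma

/-! ### The functions φ = `expQuot`, B = `bernoulliKernel` and E = `entireExpIntegral`. -/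

/-- The entire function `(1 - e^{-w}) / w`. -/
noncomputable def expQuot : ℂ → ℂ := dslope (fun w => -Complex.exp (-w)) 0

namespace expQuot

lemma mul_self (w : ℂ) : w * expQuot w = 1 - Complex.exp (-w) := by
  have := sub_smul_dslope (fun w : ℂ => -Complex.exp (-w)) 0 w
  simp only [sub_zero, smul_eq_mul, neg_zero, Complex.exp_zero, sub_neg_eq_add] at this
  rw [expQuot, this]
  ring

lemma hasDerivAt_neg_exp_neg (w : ℂ) :
    HasDerivAt (fun w : ℂ => -Complex.exp (-w)) (Complex.exp (-w)) w := by
  exact ((hasDerivAt_neg w).cexp.fun_neg).congr_deriv (by ring)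

lemma map_zero : expQuot 0 = 1 := by
  rw [expQuot, dslope_same, (hasDerivAt_neg_exp_neg 0).deriv]
  simp

lemma differentiable : Differentiable ℂ expQuot := by
  rw [← differentiableOn_univ, expQuot, Complex.differentiableOn_dslope Filter.univ_mem]
  exact fun w _ => (hasDerivAt_neg_exp_neg w).differentiableAt.differentiableWithinAt

lemma mul_deriv (w : ℂ) : w * deriv expQuot w = Complex.exp (-w) - expQuot w := by
  have h1 : HasDerivAt (fun w => w * expQuot w) (1 * expQuot w + w * deriv expQuot w) w :=
    (hasDerivAt_id w).mul (differentiable w).hasDerivAt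
  have h2 : HasDerivAt (fun w => w * expQuot w) (Complex.exp (-w)) w := by
    simp_rw [mul_self]
    simpa [sub_eq_add_neg] using (hasDerivAt_neg_exp_neg w).const_add 1
  linear_combination h1.unique h2

/-- Differentiating wφ'(w) = e^{-w} - φ(w) at 0 gives φ'(0) = -1 - φ'(0). -/
lemma deriv_zero : deriv expQuot 0 = -(1 / 2) := by
  have hd : Differentiable ℂ (deriv expQuot) := fun w =>
    ((differentiable.differentiableOn (s := Set.univ)).deriv isOpen_univ).differentiableAt
      Filter.univ_mem
  have h1 : HasDerivAt (fun w => w * deriv expQuot w)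
      (1 * deriv expQuot 0 + 0 * deriv (deriv expQuot) 0) 0 :=
    (hasDerivAt_id 0).mul (hd 0).hasDerivAt
  have h2 : HasDerivAt (fun w => w * deriv expQuot w) (-1 - deriv expQuot 0) 0 := by
    simp_rw [mul_deriv]
    have := ((hasDerivAt_neg_exp_neg 0).fun_neg).fun_sub (differentiable 0).hasDerivAt
    simpa using this
  linear_combination (1 / 2) * h1.unique h2

lemma ne_zero {w : ℂ} (hw : ‖w‖ < 2 * Real.pi) : expQuot w ≠ 0 := by
  intro h
  have h1 := mul_self w
  rw [h, mul_zero] at h1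
  obtain ⟨n, hn⟩ := Complex.exp_eq_one_iff.1 (sub_eq_zero.1 h1.symm).symm
  rcases eq_or_ne n 0 with rfl | hn0
  · have : w = 0 := by simpa using hn
    rw [this, map_zero] at h
    exact one_ne_zero h
  · have h2 : ‖w‖ = |(n : ℝ)| * (2 * Real.pi) := by
      rw [← norm_neg, hn]
      simp [abs_of_pos Real.pi_pos]
    have h3 : 1 ≤ |(n : ℝ)| := by
      have : 1 ≤ |n| := Int.one_le_abs hn0
      exact_mod_cast this
    nlinarith [Real.pi_pos]

/-- `(1 - e^{-(y+1)w}) - (1 - e^{-yw}) = e^{-yw} (1 - e^{-w})`, divided by `w`. -/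
lemma add_one_mul_sub (y w : ℂ) :
    (y + 1) * expQuot ((y + 1) * w) - y * expQuot (y * w) = Complex.exp (-(y * w)) * expQuot w := by
  rcases eq_or_ne w 0 with rfl | hw
  · simp [map_zero]
  · apply mul_left_cancel₀ hw
    have h1 := mul_self ((y + 1) * w)
    have h2 := mul_self (y * w)
    have h3 := mul_self w
    have h4 : Complex.exp (-((y + 1) * w)) = Complex.exp (-(y * w)) * Complex.exp (-w) := by
      rw [← Complex.exp_add]; ring_nf
    rw [h4] at h1
    linear_combination h1 - h2 - Complex.exp (-(y * w)) * h3

/-- The derivative of `s ↦ (1 - e^{-cs}) / c`. -/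
lemma hasDerivAt_mul_comp (c s : ℂ) :
    HasDerivAt (fun s => s * expQuot (c * s)) (Complex.exp (-(c * s))) s := by
  have h0 : HasDerivAt (fun s : ℂ => c * s) c s := by simpa using (hasDerivAt_id s).const_mul c
  have h1 : HasDerivAt (fun s => expQuot (c * s)) (deriv expQuot (c * s) * c) s :=
    ((differentiable (c * s)).hasDerivAt).comp s h0
  have h2 : HasDerivAt (fun s => s * expQuot (c * s))
      (1 * expQuot (c * s) + s * (deriv expQuot (c * s) * c)) s :=
    (hasDerivAt_id s).mul h1
  convert h2 using 1
  linear_combination -mul_deriv (c * s)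

end expQuot

/-- The function `1 / (1 - e^{-w}) - 1 / w`. -/
noncomputable def bernoulliKernel (w : ℂ) : ℂ := -dslope expQuot 0 w / expQuot w

namespace bernoulliKernel

lemma continuousOn : ContinuousOn bernoulliKernel (Metric.ball 0 (2 * Real.pi)) := by
  have h1 : Differentiable ℂ (dslope expQuot 0) := by
    rw [← differentiableOn_univ, Complex.differentiableOn_dslope Filter.univ_mem]
    exact expQuot.differentiable.differentiableOn
  refine ContinuousOn.div h1.continuous.neg.continuousOn expQuot.differentiable.continuous.continuousOn ?_
  exact fun w hw => expQuot.ne_zero (by simpa using hw)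

/-- As 1 - e^{-w} = wφ(w), the product is (1-φ)/w, and `mul_deriv` turns this into a form without
singularity at 0. -/
lemma mul_expQuot {w : ℂ} (hw : ‖w‖ < 2 * Real.pi) :
    bernoulliKernel w * expQuot w = expQuot w + deriv expQuot w := by
  rw [bernoulliKernel, div_mul_cancel₀ _ (expQuot.ne_zero hw)]
  rcases eq_or_ne w 0 with rfl | hw0
  · rw [dslope_same, expQuot.deriv_zero, expQuot.map_zero]
    norm_num
  · apply mul_left_cancel₀ hw0
    have h := sub_smul_dslope expQuot 0 w
    rw [sub_zero, smul_eq_mul, expQuot.map_zero] at h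
    linear_combination -h - expQuot.mul_self w - expQuot.mul_deriv w

lemma mul_one_sub_exp {w : ℂ} (hw : ‖w‖ < 2 * Real.pi) :
    bernoulliKernel w * (1 - Complex.exp (-w)) = 1 - expQuot w := by
  linear_combination w * mul_expQuot hw + expQuot.mul_deriv w +
    (1 - bernoulliKernel w) * expQuot.mul_self w

lemma continuousOn_segment {z : ℂ} (hz : ‖z‖ < 2 * Real.pi) :
    ContinuousOn (fun s : ℝ => bernoulliKernel (s * z)) (Set.Icc 0 1) := by
  refine continuousOn.comp (by fun_prop) fun s hs => ?_
  have h1 : |s| ≤ 1 := abs_le.2 ⟨by linarith [hs.1], hs.2⟩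
  rw [mem_ball_zero_iff, norm_mul, Complex.norm_real, Real.norm_eq_abs]
  nlinarith [norm_nonneg z]

end bernoulliKernel

/-- The entire exponential integral `∫₀^y (1 - e^{-u}) / u du`. -/
noncomputable def entireExpIntegral (y : ℂ) : ℂ :=
  ∑' n : ℕ, (-1 : ℂ) ^ n / ((n + 1 : ℕ) : ℂ) * (y ^ (n + 1) / ((n + 1).factorial : ℂ))

namespace entireExpIntegral

lemma map_zero : entireExpIntegral 0 = 0 := by simp [entireExpIntegral]

lemma tsum_eq_expQuot (y : ℂ) :
    ∑' n : ℕ, (-1 : ℂ) ^ n * (y ^ n / ((n + 1).factorial : ℂ)) = expQuot y := by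
  rcases eq_or_ne y 0 with rfl | hy
  · rw [tsum_eq_single 0 (fun n hn => by simp [hn]), expQuot.map_zero]
    simp
  · apply mul_left_cancel₀ hy
    rw [expQuot.mul_self, ← tsum_mul_left]
    have h1 := NormedSpace.expSeries_div_hasSum_exp (-y)
    rw [← Complex.exp_eq_exp_ℂ] at h1
    have h2 := ((hasSum_nat_add_iff' 1).2 h1).neg
    simp at h2
    rw [← h2.tsum_eq]
    refine tsum_congr fun n => ?_
    rw [← neg_one_mul y, mul_pow]
    ring

lemma norm_deriv_term_le (y : ℂ) (n : ℕ) :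
    ‖(-1 : ℂ) ^ n * (y ^ n / ((n + 1).factorial : ℂ))‖ ≤ ‖y‖ ^ n / (n.factorial : ℝ) := by
  rw [norm_mul, norm_pow, norm_neg, norm_one, one_pow, one_mul, norm_div, norm_pow,
    Complex.norm_natCast]
  gcongr
  exact n.le_succ

lemma hasDerivAt (y : ℂ) : HasDerivAt entireExpIntegral (expQuot y) y := by
  rw [← tsum_eq_expQuot]
  have hy : y ∈ Metric.ball (0 : ℂ) (‖y‖ + 1) := by simp
  refine hasDerivAt_tsum_of_isPreconnected (t := Metric.ball 0 (‖y‖ + 1)) (y₀ := 0)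
    (g' := fun n y => (-1 : ℂ) ^ n * (y ^ n / ((n + 1).factorial : ℂ)))
    (Real.summable_pow_div_factorial (‖y‖ + 1)) Metric.isOpen_ball
    (convex_ball _ _).isPreconnected (fun n w _ => ?_) (fun n w hw => ?_) ?_ ?_ hy
  · have h := ((hasDerivAt_pow (n + 1) w).div_const ((n + 1).factorial : ℂ)).const_mul
      ((-1 : ℂ) ^ n / ((n + 1 : ℕ) : ℂ))
    refine h.congr_deriv ?_
    have : ((n + 1 : ℕ) : ℂ) ≠ 0 := by exact_mod_cast n.succ_ne_zero
    rw [Nat.add_sub_cancel]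
    field_simp
  · refine (norm_deriv_term_le w n).trans ?_
    have : ‖w‖ < ‖y‖ + 1 := by simpa using hw
    gcongr
  · exact Metric.mem_ball_self (by positivity)
  · simp

lemma differentiable : Differentiable ℂ entireExpIntegral := fun y => (hasDerivAt y).differentiableAt

lemma norm_le (y : ℂ) : ‖entireExpIntegral y‖ ≤ ‖y‖ * Real.exp ‖y‖ := by
  have h := (NormedSpace.expSeries_div_hasSum_exp ‖y‖).mul_left ‖y‖
  rw [← Real.exp_eq_exp_ℝ] at h
  refine tsum_of_norm_bounded h fun n => ?_
  have h1 : (-1 : ℂ) ^ n / ((n + 1 : ℕ) : ℂ) * (y ^ (n + 1) / ((n + 1).factorial : ℂ)) =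
      y * (1 / ((n + 1 : ℕ) : ℂ)) * ((-1 : ℂ) ^ n * (y ^ n / ((n + 1).factorial : ℂ))) := by
    ring
  rw [h1, norm_mul, norm_mul]
  refine mul_le_mul ?_ (norm_deriv_term_le y n) (norm_nonneg _) (norm_nonneg _)
  refine mul_le_of_le_one_right (norm_nonneg _) ?_
  rw [norm_div, norm_one, Complex.norm_natCast]
  refine (div_le_one (by positivity)).2 ?_
  exact_mod_cast Nat.succ_le_succ n.zero_le

end entireExpIntegral

/-! ### Integration tools on [0, 1] and [1, 2]. -/

/-- The finite Laplace transform of a continuous function is entire. -/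
lemma hasDerivAt_integral_mul_exp {g : ℝ → ℂ} (hg : ContinuousOn g (Set.Icc 0 1)) (z : ℂ) :
    HasDerivAt (fun z : ℂ => ∫ x in (0 : ℝ)..1, g x * Complex.exp (-z * (x : ℂ)))
      (∫ x in (0 : ℝ)..1, -(x : ℂ) * (g x * Complex.exp (-z * (x : ℂ)))) z := by
  obtain ⟨C, hC⟩ := isCompact_Icc.exists_bound_of_continuousOn hg
  have hu : Set.uIcc (0 : ℝ) 1 = Set.Icc 0 1 := Set.uIcc_of_le zero_le_one
  have hg' : ContinuousOn g (Set.uIcc 0 1) := by rwa [hu]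
  have hc1 : ∀ z : ℂ, IntervalIntegrable (fun x : ℝ => g x * Complex.exp (-z * (x : ℂ)))
      MeasureTheory.volume 0 1 := fun z =>
    ContinuousOn.intervalIntegrable (hg'.mul (by fun_prop))
  have hc2 : IntervalIntegrable (fun x : ℝ => -(x : ℂ) * (g x * Complex.exp (-z * (x : ℂ))))
      MeasureTheory.volume 0 1 :=
    ContinuousOn.intervalIntegrable (ContinuousOn.mul (by fun_prop) (hg'.mul (by fun_prop)))
  refine (intervalIntegral.hasDerivAt_integral_of_dominated_loc_of_deriv_le
    (F := fun (z : ℂ) (x : ℝ) => g x * Complex.exp (-z * (x : ℂ)))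
    (F' := fun (z : ℂ) (x : ℝ) => -(x : ℂ) * (g x * Complex.exp (-z * (x : ℂ))))
    (bound := fun _ => C * Real.exp (‖z‖ + 1))
    (Metric.ball_mem_nhds z one_pos) ?_ (hc1 z) ?_ ?_ intervalIntegrable_const ?_).2
  · exact Filter.Eventually.of_forall fun w => (hc1 w).def'.aestronglyMeasurable
  · exact hc2.def'.aestronglyMeasurable
  · refine Filter.Eventually.of_forall fun x hx w hw => ?_
    rw [Set.uIoc_of_le zero_le_one] at hx
    have h1 : ‖(x : ℂ)‖ ≤ 1 := by
      rw [Complex.norm_real, Real.norm_eq_abs, abs_of_pos hx.1]; exact hx.2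
    have h2 : ‖w‖ ≤ ‖z‖ + 1 := by
      have h3 : ‖w - z‖ < 1 := by simpa [dist_eq_norm] using hw
      have := norm_add_le (w - z) z
      rw [sub_add_cancel] at this
      linarith
    have h4 : ‖g x‖ ≤ C := hC x ⟨hx.1.le, hx.2⟩
    rw [norm_mul, norm_neg, norm_mul]
    refine (mul_le_of_le_one_left (by positivity) h1).trans ?_
    refine mul_le_mul h4 ?_ (norm_nonneg _) ((norm_nonneg _).trans h4)
    refine (Complex.norm_exp_le_exp_norm _).trans ?_
    gcongr
    rw [norm_mul, norm_neg]
    exact (mul_le_of_le_one_right (norm_nonneg _) h1).trans h2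
  · refine Filter.Eventually.of_forall fun x _ w _ => ?_
    have h1 : HasDerivAt (fun w : ℂ => -w * (x : ℂ)) (-(x : ℂ)) w := by
      simpa using (hasDerivAt_neg w).mul_const (x : ℂ)
    exact (h1.cexp.const_mul (g x)).congr_deriv (by ring)

lemma norm_integral_mul_exp_le {g : ℝ → ℂ} {C : ℝ} (hC : ∀ x ∈ Set.Icc (0 : ℝ) 1, ‖g x‖ ≤ C)
    (z : ℂ) : ‖∫ x in (0 : ℝ)..1, g x * Complex.exp (-z * (x : ℂ))‖ ≤ C * Real.exp ‖z‖ := by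
  have := intervalIntegral.norm_integral_le_of_norm_le_const (a := (0 : ℝ)) (b := 1)
    (f := fun x : ℝ => g x * Complex.exp (-z * (x : ℂ))) (C := C * Real.exp ‖z‖) (fun x hx => by
      rw [Set.uIoc_of_le zero_le_one] at hx
      have h1 : ‖(x : ℂ)‖ ≤ 1 := by
        rw [Complex.norm_real, Real.norm_eq_abs, abs_of_pos hx.1]; exact hx.2
      have h4 : ‖g x‖ ≤ C := hC x ⟨hx.1.le, hx.2⟩
      rw [norm_mul]
      refine mul_le_mul h4 ?_ (norm_nonneg _) ((norm_nonneg _).trans h4)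
      refine (Complex.norm_exp_le_exp_norm _).trans ?_
      gcongr
      rw [norm_mul, norm_neg]
      exact mul_le_of_le_one_right (norm_nonneg _) h1)
  simpa using this

/-- Fubini's theorem for a continuous function on a rectangle. -/
lemma intervalIntegral_swap_of_continuousOn {f : ℝ → ℝ → ℂ} {a b c d : ℝ} (hab : a ≤ b) (hcd : c ≤ d)
    (hf : ContinuousOn (Function.uncurry f) (Set.Icc a b ×ˢ Set.Icc c d)) :
    ∫ x in a..b, ∫ y in c..d, f x y = ∫ y in c..d, ∫ x in a..b, f x y := by
  simp_rw [intervalIntegral.integral_of_le hab, intervalIntegral.integral_of_le hcd]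
  refine MeasureTheory.integral_integral_swap ?_
  rw [MeasureTheory.Measure.prod_restrict]
  have h := hf.integrableOn_compact (μ := (MeasureTheory.volume : MeasureTheory.Measure ℝ).prod
    MeasureTheory.volume) (isCompact_Icc.prod isCompact_Icc)
  exact h.mono_set (Set.prod_mono Set.Ioc_subset_Icc_self Set.Ioc_subset_Icc_self)

lemma norm_ofReal_mul_lt {z : ℂ} {τ : ℝ} (hz : ‖z‖ < τ) {s : ℝ} (hs : s ∈ Set.Icc (0 : ℝ) 1) :
    ‖(s : ℂ) * z‖ < τ := by
  refine lt_of_le_of_lt ?_ hz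
  rw [norm_mul, Complex.norm_real, Real.norm_eq_abs, abs_of_nonneg hs.1]
  exact mul_le_of_le_one_left (norm_nonneg _) hs.2

/-- The fundamental theorem of calculus on `[0, 1]` for a function with a complex derivative. -/
lemma integral_unit_eq_sub {F f : ℂ → ℂ} (hF : ∀ s : ℝ, s ∈ Set.Icc (0 : ℝ) 1 → HasDerivAt F (f s) s)
    (hf : ContinuousOn (fun s : ℝ => f s) (Set.Icc 0 1)) :
    ∫ s in (0 : ℝ)..1, f s = F 1 - F 0 := by
  have hu : Set.uIcc (0 : ℝ) 1 = Set.Icc 0 1 := Set.uIcc_of_le zero_le_one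
  have := intervalIntegral.integral_eq_sub_of_hasDerivAt (a := 0) (b := 1)
    (f := fun s : ℝ => F s) (f' := fun s : ℝ => f s)
    (fun s hs => (hF s (by rwa [hu] at hs)).comp_ofReal)
    (ContinuousOn.intervalIntegrable (by rwa [hu]))
  simpa using this

lemma integral_one_two_eq_sub {F f : ℂ → ℂ} (hF : ∀ s : ℂ, HasDerivAt F (f s) s)
    (hf : Continuous f) :
    ∫ s in (1 : ℝ)..2, f s = F 2 - F 1 := by
  have := intervalIntegral.integral_eq_sub_of_hasDerivAt (a := 1) (b := 2)
    (f := fun s : ℝ => F s) (f' := fun s : ℝ => f s)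
    (fun s _ => (hF s).comp_ofReal)
    (Continuous.intervalIntegrable (by fun_prop) _ _)
  simpa using this

lemma hasDerivAt_const_mul_id (c s : ℂ) : HasDerivAt (fun s : ℂ => c * s) c s := by
  simpa using (hasDerivAt_id s).const_mul c

lemma entireExpIntegral.hasDerivAt_comp_mul (c s : ℂ) :
    HasDerivAt (fun s => entireExpIntegral (c * s)) (expQuot (c * s) * c) s :=
  (entireExpIntegral.hasDerivAt (c * s)).comp s (hasDerivAt_const_mul_id c s)

lemma expQuot.hasDerivAt_comp_mul (c s : ℂ) :
    HasDerivAt (fun s => expQuot (c * s)) (deriv expQuot (c * s) * c) s :=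
  (expQuot.differentiable (c * s)).hasDerivAt.comp s (hasDerivAt_const_mul_id c s)

/-! ### The function Λ_z. -/

/-- The integral `-∫₀^z (e^{-yw}/(1 - e^{-w}) - 1/w) dw`, as a function of `y`. -/
noncomputable def lerchIntegral (z y : ℂ) : ℂ :=
  entireExpIntegral (y * z) -
    z * ∫ s in (0 : ℝ)..1, bernoulliKernel (s * z) * Complex.exp (-(y * z) * (s : ℂ))

namespace lerchIntegral

variable {z : ℂ}

/-- The definition rests on e^{-yw}/(1-e^{-w}) - 1/w = B(w)e^{-yw} - (1-e^{-yw})/w with w = sz: both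
terms are regular at w = 0 and their integrals are entire in y. -/
lemma differentiable (hz : ‖z‖ < 2 * Real.pi) : Differentiable ℂ (lerchIntegral z) := by
  intro y
  have h1 : DifferentiableAt ℂ (fun y : ℂ => y * z) y := by fun_prop
  have h2 := (hasDerivAt_integral_mul_exp (bernoulliKernel.continuousOn_segment hz)
    (y * z)).differentiableAt
  have h3 := DifferentiableAt.comp y h2 h1
  have h4 := DifferentiableAt.comp y (entireExpIntegral.differentiable (y * z)) h1
  exact h4.sub (h3.const_mul z)

lemma exists_norm_le (hz : ‖z‖ < 2 * Real.pi) :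
    ∃ C : ℝ, 0 ≤ C ∧ ∀ y : ℂ, ‖lerchIntegral z y‖ ≤ C * (1 + ‖y‖) * Real.exp (‖z‖ * ‖y‖) := by
  obtain ⟨C, hC⟩ := isCompact_Icc.exists_bound_of_continuousOn
    (bernoulliKernel.continuousOn_segment hz)
  have hC0 : 0 ≤ C := (norm_nonneg _).trans (hC 0 ⟨le_rfl, zero_le_one⟩)
  refine ⟨‖z‖ * (1 + C), by positivity, fun y => ?_⟩
  have h1 := entireExpIntegral.norm_le (y * z)
  have h2 := norm_integral_mul_exp_le hC (y * z)
  rw [norm_mul, mul_comm ‖y‖] at h1 h2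
  refine (norm_sub_le _ _).trans ?_
  rw [norm_mul]
  have h3 : ‖z‖ * ‖∫ s in (0 : ℝ)..1, bernoulliKernel (s * z) * Complex.exp (-(y * z) * (s : ℂ))‖ ≤
      ‖z‖ * (C * Real.exp (‖z‖ * ‖y‖)) := mul_le_mul_of_nonneg_left h2 (norm_nonneg _)
  have h4 : 0 ≤ ‖z‖ * Real.exp (‖z‖ * ‖y‖) := by positivity
  have h5 := norm_nonneg y
  calc _ ≤ ‖z‖ * ‖y‖ * Real.exp (‖z‖ * ‖y‖) + ‖z‖ * (C * Real.exp (‖z‖ * ‖y‖)) := add_le_add h1 h3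
    _ = (‖y‖ + C) * (‖z‖ * Real.exp (‖z‖ * ‖y‖)) := by ring
    _ ≤ ((1 + C) * (1 + ‖y‖)) * (‖z‖ * Real.exp (‖z‖ * ‖y‖)) := by
        gcongr
        nlinarith
    _ = _ := by ring

lemma intervalIntegrable (hz : ‖z‖ < 2 * Real.pi) (y : ℂ) :
    IntervalIntegrable (fun s : ℝ => bernoulliKernel (s * z) * Complex.exp (-(y * z) * (s : ℂ)))
      MeasureTheory.volume 0 1 := by
  refine ContinuousOn.intervalIntegrable ?_
  rw [Set.uIcc_of_le zero_le_one]
  exact (bernoulliKernel.continuousOn_segment hz).mul (by fun_prop)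

/-- Subtracting the two integrands cancels 1 - e^{-w} and leaves ∫_0^z e^{-yw} dw. -/
lemma map_add_one (hz : ‖z‖ < 2 * Real.pi) (y : ℂ) :
    lerchIntegral z (y + 1) = lerchIntegral z y + z * expQuot (y * z) := by
  have hm := expQuot.differentiable.continuous
  have h1 : ∫ s in (0 : ℝ)..1, z * (Complex.exp (-(y * z * s)) * (1 - expQuot (z * s))) =
      z * expQuot (y * z) - entireExpIntegral ((y + 1) * z) + entireExpIntegral (y * z) := by
    -- The E terms of the antiderivative come from e^{-yw}φ(w) = (y+1)φ((y+1)w) - yφ(yw).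
    have := integral_unit_eq_sub
      (F := fun s => z * (s * expQuot (y * z * s)) - entireExpIntegral ((y + 1) * z * s) +
        entireExpIntegral (y * z * s))
      (f := fun s => z * (Complex.exp (-(y * z * s)) * (1 - expQuot (z * s))))
      (fun s _ => by
        have h := (((expQuot.hasDerivAt_mul_comp (y * z) s).const_mul z).fun_sub
          (entireExpIntegral.hasDerivAt_comp_mul ((y + 1) * z) s)).fun_add
          (entireExpIntegral.hasDerivAt_comp_mul (y * z) s)
        refine h.congr_deriv ?_
        have h2 := expQuot.add_one_mul_sub y (z * s)
        rw [← mul_assoc, ← mul_assoc] at h2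
        linear_combination -z * h2)
      (by fun_prop)
    rw [this]
    simp [entireExpIntegral.map_zero]
  have h2 : (∫ s in (0 : ℝ)..1, bernoulliKernel (s * z) * Complex.exp (-(y * z) * (s : ℂ))) -
      ∫ s in (0 : ℝ)..1, bernoulliKernel (s * z) * Complex.exp (-((y + 1) * z) * (s : ℂ)) =
      ∫ s in (0 : ℝ)..1, Complex.exp (-(y * z * s)) * (1 - expQuot (z * s)) := by
    rw [← intervalIntegral.integral_sub (intervalIntegrable hz y) (intervalIntegrable hz (y + 1))]
    refine intervalIntegral.integral_congr fun s hs => ?_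
    rw [Set.uIcc_of_le zero_le_one] at hs
    have h3 := bernoulliKernel.mul_one_sub_exp (norm_ofReal_mul_lt hz hs)
    have h4 : Complex.exp (-((y + 1) * z) * (s : ℂ)) =
        Complex.exp (-(y * z * s)) * Complex.exp (-(s * z)) := by
      rw [← Complex.exp_add]; ring_nf
    have h5 : -(y * z) * (s : ℂ) = -(y * z * s) := by ring
    rw [h4, h5, mul_comm z (s : ℂ), ← h3]
    ring
  rw [intervalIntegral.integral_const_mul, ← h2] at h1
  rw [lerchIntegral, lerchIntegral]
  linear_combination h1

/-- Since ∫_1^2 e^{-tw} dt = e^{-w}(1-e^{-w})/w, integrating in t first cancels the denominator and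
leaves ∫_0^z (1-e^{-w})/w dw. The two terms of the definition are integrated separately; the values
E(2z) cancel. -/
lemma intervalIntegral_eq (hz : ‖z‖ < 2 * Real.pi) :
    ∫ t in (1 : ℝ)..2, lerchIntegral z t = entireExpIntegral z := by
  have hm := expQuot.differentiable.continuous
  have hE := entireExpIntegral.differentiable.continuous
  have hdiff : ∫ t in (1 : ℝ)..2, lerchIntegral z t =
      (∫ t in (1 : ℝ)..2, entireExpIntegral (z * t)) - z * ∫ t in (1 : ℝ)..2,
        ∫ s in (0 : ℝ)..1, bernoulliKernel (s * z) * Complex.exp (-(t * z) * (s : ℂ)) := by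
    rw [← intervalIntegral.integral_const_mul, ← intervalIntegral.integral_sub]
    · refine intervalIntegral.integral_congr fun t _ => ?_
      simp only [lerchIntegral]
      rw [mul_comm (t : ℂ) z]
    · exact Continuous.intervalIntegrable (by fun_prop) _ _
    · have h1 : Continuous fun t : ℝ => lerchIntegral z t :=
        (differentiable hz).continuous.comp Complex.continuous_ofReal
      have h2 : Continuous fun t : ℝ => entireExpIntegral (z * t) - lerchIntegral z t := by fun_prop
      refine (h2.congr fun t => ?_).intervalIntegrable _ _
      rw [lerchIntegral, mul_comm z (t : ℂ)]
      ring
  have hfirst : ∫ t in (1 : ℝ)..2, entireExpIntegral (z * t) =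
      2 * entireExpIntegral (2 * z) - entireExpIntegral z - 1 + Complex.exp (-z) * expQuot z := by
    -- Integration by parts: t E(zt) has derivative E(zt) + 1 - e^{-zt}, and -t + tφ(zt) corrects
    -- the excess.
    have := integral_one_two_eq_sub
      (F := fun t => t * entireExpIntegral (z * t) - t + t * expQuot (z * t))
      (f := fun t => entireExpIntegral (z * t))
      (fun t => by
        have h := (((hasDerivAt_id t).fun_mul (entireExpIntegral.hasDerivAt_comp_mul z t)).fun_sub
          (hasDerivAt_id t)).fun_add (expQuot.hasDerivAt_mul_comp z t)
        refine h.congr_deriv ?_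
        have h2 := expQuot.mul_self (z * t)
        simp only [id]
        linear_combination h2)
      (by fun_prop)
    rw [this]
    have h3 := expQuot.add_one_mul_sub 1 z
    norm_num at h3
    rw [mul_comm z 2]
    simp only [one_mul, mul_one]
    linear_combination h3
  have hinner : ∀ s : ℝ, s ∈ Set.Icc (0 : ℝ) 1 →
      ∫ t in (1 : ℝ)..2, bernoulliKernel (s * z) * Complex.exp (-(t * z) * (s : ℂ)) =
      Complex.exp (-(z * s)) * (expQuot (z * s) + deriv expQuot (z * s)) := by
    intro s hs
    have h1 : ∫ t in (1 : ℝ)..2, Complex.exp (-(z * s * t)) =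
        Complex.exp (-(z * s)) * expQuot (z * s) := by
      have := integral_one_two_eq_sub (F := fun t => t * expQuot (z * s * t))
        (f := fun t => Complex.exp (-(z * s * t)))
        (fun t => expQuot.hasDerivAt_mul_comp (z * s) t) (by fun_prop)
      rw [this]
      have h3 := expQuot.add_one_mul_sub 1 (z * s)
      norm_num at h3
      rw [mul_comm (z * s : ℂ) 2]
      simp only [one_mul, mul_one]
      exact h3
    rw [intervalIntegral.integral_const_mul]
    have h4 : ∫ t in (1 : ℝ)..2, Complex.exp (-(t * z) * (s : ℂ)) =
        ∫ t in (1 : ℝ)..2, Complex.exp (-(z * s * t)) := by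
      congr 1; funext t; ring_nf
    rw [h4, h1]
    have h5 := bernoulliKernel.mul_expQuot (norm_ofReal_mul_lt hz hs)
    rw [mul_comm z (s : ℂ), ← h5]
    ring
  have hd' : Continuous (deriv expQuot) :=
    (expQuot.differentiable.contDiff (n := 1)).continuous_deriv le_rfl
  have hsecond : z * ∫ t in (1 : ℝ)..2,
      ∫ s in (0 : ℝ)..1, bernoulliKernel (s * z) * Complex.exp (-(t * z) * (s : ℂ)) =
      2 * entireExpIntegral (2 * z) - 2 * entireExpIntegral z + Complex.exp (-z) * expQuot z - 1 := by
    rw [intervalIntegral_swap_of_continuousOn one_le_two zero_le_one, ← intervalIntegral.integral_const_mul]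
    · have h1 : ∫ s in (0 : ℝ)..1, z * ∫ t in (1 : ℝ)..2, bernoulliKernel (s * z) * Complex.exp (-(t * z) * (s : ℂ)) =
          ∫ s in (0 : ℝ)..1, z * (Complex.exp (-(z * s)) * (expQuot (z * s) + deriv expQuot (z * s))) := by
        refine intervalIntegral.integral_congr fun s hs => ?_
        rw [Set.uIcc_of_le zero_le_one] at hs
        rw [hinner s hs]
      rw [h1]
      have := integral_unit_eq_sub
        (F := fun s => 2 * entireExpIntegral (2 * z * s) - 2 * entireExpIntegral (z * s) +
          Complex.exp (-(z * s)) * expQuot (z * s))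
        (f := fun s => z * (Complex.exp (-(z * s)) * (expQuot (z * s) + deriv expQuot (z * s))))
        (fun s _ => by
          have h := (((entireExpIntegral.hasDerivAt_comp_mul (2 * z) s).const_mul 2).fun_sub
            ((entireExpIntegral.hasDerivAt_comp_mul z s).const_mul 2)).fun_add
            (((hasDerivAt_const_mul_id z s).fun_neg.cexp).fun_mul (expQuot.hasDerivAt_comp_mul z s))
          refine h.congr_deriv ?_
          have h3 := expQuot.add_one_mul_sub 1 (z * s)
          norm_num at h3
          rw [← mul_assoc] at h3
          linear_combination 2 * z * h3)
        (by fun_prop)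
      rw [this]
      simp [entireExpIntegral.map_zero, expQuot.map_zero]
    · refine ContinuousOn.mul ?_ (by fun_prop)
      exact (bernoulliKernel.continuousOn_segment hz).comp continuous_snd.continuousOn
        fun p hp => hp.2
  rw [hdiff, hfirst, hsecond]
  ring

end lerchIntegral

/-! ### The principal logarithm and Λ_z(1). -/

/-- `sinh(z/2) / (z/2)` has positive real part in the strip `|Im z| < π`. -/
lemma re_exp_half_mul_expQuot_pos {z : ℂ} (hz : |z.im| < Real.pi) :
    0 < (Complex.exp (z / 2) * expQuot z).re := by
  rcases eq_or_ne z 0 with rfl | h0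
  · simp [expQuot.map_zero]
  have h1 : Complex.exp (z / 2) * expQuot z = Complex.sinh (z / 2) / (z / 2) := by
    rw [eq_div_iff (by simpa using h0), Complex.sinh]
    have h2 := expQuot.mul_self z
    have h3 : Complex.exp (-(z / 2)) = Complex.exp (z / 2) * Complex.exp (-z) := by
      rw [← Complex.exp_add]; ring_nf
    rw [h3]
    linear_combination Complex.exp (z / 2) / 2 * h2
  rw [h1]
  set w := z / 2 with hw
  have hw0 : w ≠ 0 := by simpa [hw] using h0
  have him : |w.im| < Real.pi / 2 := by
    have : w.im = z.im / 2 := by simp [hw]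
    rw [this, abs_div, abs_two]
    linarith
  have hpos : 0 < Complex.normSq w := Complex.normSq_pos.2 hw0
  have hs : Complex.sinh w = Complex.sinh (w.re : ℂ) * Complex.cos (w.im : ℂ) +
      Complex.cosh (w.re : ℂ) * Complex.sin (w.im : ℂ) * Complex.I := by
    conv_lhs => rw [← Complex.re_add_im w]
    rw [Complex.sinh_add, Complex.cosh_mul_I, Complex.sinh_mul_I]
    ring
  have hre : (Complex.sinh w).re = Real.sinh w.re * Real.cos w.im := by
    rw [hs, ← Complex.ofReal_sinh, ← Complex.ofReal_cos, ← Complex.ofReal_cosh, ← Complex.ofReal_sin]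
    simp only [Complex.add_re, Complex.mul_re, Complex.mul_im, Complex.ofReal_re,
      Complex.ofReal_im, Complex.I_re, Complex.I_im]
    ring
  have hi : (Complex.sinh w).im = Real.cosh w.re * Real.sin w.im := by
    rw [hs, ← Complex.ofReal_sinh, ← Complex.ofReal_cos, ← Complex.ofReal_cosh, ← Complex.ofReal_sin]
    simp only [Complex.add_im, Complex.mul_re, Complex.mul_im, Complex.ofReal_re,
      Complex.ofReal_im, Complex.I_re, Complex.I_im]
    ring
  -- For w = a + bi the numerator is cos b · a sinh a + cosh a · b sin b, whose terms are
  -- nonnegative and not both zero.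
  rw [Complex.div_re, hre, hi, ← add_div]
  refine div_pos ?_ hpos
  have hcos : 0 < Real.cos w.im := Real.cos_pos_of_mem_Ioo (abs_lt.1 him |>.imp (by intro h; linarith) id)
  have hcosh := Real.cosh_pos w.re
  have h4 : 0 ≤ Real.sinh w.re * w.re := by
    rcases le_total 0 w.re with h | h
    · exact mul_nonneg (Real.sinh_nonneg_iff.2 h) h
    · exact mul_nonneg_of_nonpos_of_nonpos (Real.sinh_nonpos_iff.2 h) h
  have h5 : 0 ≤ Real.sin w.im * w.im := by
    have hab := abs_lt.1 him
    rcases le_total 0 w.im with h | h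
    · exact mul_nonneg (Real.sin_nonneg_of_nonneg_of_le_pi h (by linarith [Real.pi_pos])) h
    · exact mul_nonneg_of_nonpos_of_nonpos
        (Real.sin_nonpos_of_nonpos_of_neg_pi_le h (by linarith [Real.pi_pos])) h
  have h6 : Real.sinh w.re * w.re ≠ 0 ∨ Real.sin w.im * w.im ≠ 0 := by
    by_contra! hcon
    have h7 : w.re = 0 := by
      rcases mul_eq_zero.1 hcon.1 with h | h
      · exact Real.sinh_eq_zero.1 h
      · exact h
    have h8 : w.im = 0 := by
      rcases mul_eq_zero.1 hcon.2 with h | h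
      · have hab := abs_lt.1 him
        exact (Real.sin_eq_zero_iff_of_lt_of_lt (by linarith [Real.pi_pos])
          (by linarith [Real.pi_pos])).1 h
      · exact h
    exact hw0 (Complex.ext h7 h8)
  have h9 : Real.sinh w.re * Real.cos w.im * w.re + Real.cosh w.re * Real.sin w.im * w.im =
      Real.cos w.im * (Real.sinh w.re * w.re) + Real.cosh w.re * (Real.sin w.im * w.im) := by ring
  rw [h9]
  rcases h6 with h | h
  · have := lt_of_le_of_ne h4 h.symm
    positivity
  · have := lt_of_le_of_ne h5 h.symm
    positivity

/-- The principal logarithm of `z / (1 - e^{-z})`. -/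
lemma log_div_one_sub_exp_neg {z : ℂ} (hz : |z.im| < Real.pi) (h0 : z ≠ 0) :
    Complex.log (z / (1 - Complex.exp (-z))) =
      z / 2 - Complex.log (Complex.exp (z / 2) * expQuot z) := by
  have hp := re_exp_half_mul_expQuot_pos hz
  set M := Complex.exp (z / 2) * expQuot z with hM
  have hM0 : M ≠ 0 := fun h => by rw [h] at hp; simp at hp
  have h1 : z / (1 - Complex.exp (-z)) = Complex.exp (z / 2 - Complex.log M) := by
    have hq : expQuot z ≠ 0 := fun h => hM0 (by rw [hM, h, mul_zero])
    rw [Complex.exp_sub, Complex.exp_log hM0, ← expQuot.mul_self, hM]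
    field_simp [Complex.exp_ne_zero]
  -- Both arg M and Im z/2 lie in (-π/2, π/2), so z/2 - log M is in the strip where the principal
  -- logarithm inverts exp.
  have harg := Complex.abs_arg_lt_pi_div_two_iff.2 (Or.inl hp)
  have h2 := abs_lt.1 harg
  have h3 := abs_lt.1 hz
  have him : (z / 2 - Complex.log M).im = z.im / 2 - Complex.arg M := by
    simp [Complex.log_im]
  rw [h1, Complex.log_exp] <;> rw [him] <;> linarith

/-- The integrand e^{-w}/(1-e^{-w}) - 1/w is the logarithmic derivative of φ. Writing log φ as
log(e^{w/2}φ) - w/2 keeps the argument of the logarithm in the right half-plane along the segment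
from 0 to z. -/
lemma lerchIntegral.map_one {z : ℂ} (hz : ‖z‖ < Real.pi) :
    lerchIntegral z 1 = z / 2 - Complex.log (Complex.exp (z / 2) * expQuot z) := by
  have hz2 : ‖z‖ < 2 * Real.pi := by linarith [Real.pi_pos]
  have hm := expQuot.differentiable.continuous
  have hseg : ∀ s : ℝ, s ∈ Set.Icc (0 : ℝ) 1 → ‖z * s‖ < Real.pi := fun s hs => by
    rw [mul_comm]; exact norm_ofReal_mul_lt hz hs
  have h1 : ∫ s in (0 : ℝ)..1, z * (bernoulliKernel (s * z) * Complex.exp (-(1 * z) * (s : ℂ))) =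
      entireExpIntegral z - z / 2 + Complex.log (Complex.exp (z / 2) * expQuot z) := by
    have := integral_unit_eq_sub
      (F := fun s => entireExpIntegral (z * s) - z / 2 * s +
        Complex.log (Complex.exp (z / 2 * s) * expQuot (z * s)))
      (f := fun s => z * (bernoulliKernel (s * z) * Complex.exp (-(1 * z) * s)))
      (fun s hs => by
        have hs1 := hseg s hs
        have hq := expQuot.ne_zero (hs1.trans (by linarith [Real.pi_pos]))
        have hsl : Complex.exp (z / 2 * s) * expQuot (z * s) ∈ Complex.slitPlane := by
          refine Or.inl ?_
          have := re_exp_half_mul_expQuot_pos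
            (lt_of_le_of_lt (Complex.abs_im_le_norm (z * s)) hs1)
          rwa [show z * (s : ℂ) / 2 = z / 2 * s by ring] at this
        have h := ((entireExpIntegral.hasDerivAt_comp_mul z s).fun_sub
          (hasDerivAt_const_mul_id (z / 2) s)).fun_add
          (HasDerivAt.clog (((hasDerivAt_const_mul_id (z / 2) (s : ℂ)).cexp).fun_mul
            (expQuot.hasDerivAt_comp_mul z s)) hsl)
        refine h.congr_deriv ?_
        have h2 := bernoulliKernel.mul_expQuot (norm_ofReal_mul_lt hz2 hs)
        have h3 := expQuot.mul_self (z * s)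
        have h4 := bernoulliKernel.mul_one_sub_exp (norm_ofReal_mul_lt hz2 hs)
        rw [mul_comm (s : ℂ) z] at h2 h4 ⊢
        rw [show -(1 * z) * (s : ℂ) = -(z * s) by ring]
        have hexp := Complex.exp_ne_zero (z / 2 * s)
        field_simp
        linear_combination 2 * z * expQuot (z * s) * h4 - 2 * z * h2)
      (by
        refine ContinuousOn.mul continuousOn_const ?_
        exact (bernoulliKernel.continuousOn_segment hz2).mul (by fun_prop))
    rw [this]
    simp [entireExpIntegral.map_zero, expQuot.map_zero]
  rw [intervalIntegral.integral_const_mul] at h1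
  rw [lerchIntegral, h1, one_mul]
  ring

/-! ### Growth bounds and normalisation of solutions. -/

/-- Half of the gap τ - r absorbs the linear factor. -/
lemma ExpGrowthLT.of_norm_le {f : ℂ → ℂ} {A r τ : ℝ} (hr : r < τ)
    (h : ∀ x : ℂ, 0 < x.re → ‖f x‖ ≤ A * (1 + ‖x‖) * Real.exp (r * ‖x‖)) : ExpGrowthLT τ f := by
  obtain ⟨ε, hε, hετ⟩ : ∃ ε : ℝ, 0 < ε ∧ r + ε < τ := ⟨(τ - r) / 2, by linarith, by linarith⟩
  refine ⟨r + ε, hετ, (|A| + 1) * (1 + 1 / ε), by positivity, fun x hx => (h x hx).trans ?_⟩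
  have h1 : 1 + ‖x‖ ≤ (1 + 1 / ε) * Real.exp (ε * ‖x‖) := by
    have h2 : 1 + ε * ‖x‖ ≤ Real.exp (ε * ‖x‖) := by
      linarith [Real.add_one_le_exp (ε * ‖x‖)]
    calc 1 + ‖x‖ ≤ (1 + 1 / ε) * (1 + ε * ‖x‖) := by
          have h3 : (1 + 1 / ε) * (1 + ε * ‖x‖) = 1 + ‖x‖ + (1 / ε + ε * ‖x‖) := by
            field_simp
            ring
          have : 0 ≤ 1 / ε + ε * ‖x‖ := by positivity
          linarith
      _ ≤ _ := by gcongr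
  calc A * (1 + ‖x‖) * Real.exp (r * ‖x‖) ≤
      (|A| + 1) * ((1 + 1 / ε) * Real.exp (ε * ‖x‖)) * Real.exp (r * ‖x‖) := by
        gcongr
        linarith [le_abs_self A]
    _ = _ := by rw [add_mul r ε, Real.exp_add]; ring

lemma ExpGrowthLT.const {τ : ℝ} (hτ : 0 < τ) (c : ℂ) : ExpGrowthLT τ (fun _ => c) :=
  ExpGrowthLT.of_norm_le (A := ‖c‖) (r := 0) hτ fun x _ => by
    have := mul_nonneg (norm_nonneg c) (norm_nonneg x)
    simp
    linarith

lemma ExpGrowthLT.const_mul {τ : ℝ} {f : ℂ → ℂ} (hf : ExpGrowthLT τ f) (c : ℂ) :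
    ExpGrowthLT τ (fun x => c * f x) := by
  obtain ⟨α, hα, K, hK, hb⟩ := hf
  refine ⟨α, hα, (‖c‖ + 1) * K, by positivity, fun x hx => ?_⟩
  rw [norm_mul, mul_assoc]
  exact mul_le_mul (by linarith) (hb x hx) (norm_nonneg _) (by positivity)

lemma ExpGrowthLT.add {τ : ℝ} {f g : ℂ → ℂ} (hf : ExpGrowthLT τ f) (hg : ExpGrowthLT τ g) :
    ExpGrowthLT τ (fun x => f x + g x) := by
  simpa using hf.sub (hg.const_mul (-1))

lemma isOpen_right_half_plane : IsOpen {x : ℂ | 0 < x.re} :=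
  isOpen_lt continuous_const Complex.continuous_re

/-- Any solution of the difference equation can be normalised. -/
lemma hasRamanujanSum_of_difference {u : ℕ → ℂ} {a R : ℂ → ℂ}
    (ha : DifferentiableOn ℂ a {x : ℂ | 0 < x.re}) (hag : ExpGrowthLT Real.pi a)
    (hau : ∀ n : ℕ, 1 ≤ n → a n = u n) (hR : DifferentiableOn ℂ R {x : ℂ | 0 < x.re})
    (hRg : ExpGrowthLT (2 * Real.pi) R) (hd : ∀ x : ℂ, 0 < x.re → R x - R (x + 1) = a x) :
    HasRamanujanSum u (R 1 - ∫ t in (1 : ℝ)..2, R t) := by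
  have hRa : AnalyticOnNhd ℂ R {x : ℂ | 0 < x.re} := hR.analyticOnNhd isOpen_right_half_plane
  refine ⟨a, fun x => R x - ∫ t in (1 : ℝ)..2, R t, ha.analyticOnNhd isOpen_right_half_plane, hag, hau,
    ⟨hRa.sub analyticOnNhd_const, hRg.sub (ExpGrowthLT.const Real.two_pi_pos _), fun x hx => ?_, ?_⟩,
    rfl⟩
  · rw [← hd x hx]
    ring
  · rw [intervalIntegral.integral_sub _ intervalIntegrable_const]
    · norm_num
    · refine ContinuousOn.intervalIntegrable ((continuousOn_ofReal_of_analyticOnNhd hRa).mono ?_)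
      rw [Set.uIcc_of_le (by norm_num)]
      exact fun t ht => lt_of_lt_of_le one_pos ht.1

lemma re_gt_neg_half_of_pos {x : ℂ} (hx : 0 < x.re) : -(1 / 2) < x.re := by linarith

lemma add_one_ne_zero_of_re_pos {x : ℂ} (hx : 0 < x.re) : x + 1 ≠ 0 := fun h => by
  have := congrArg Complex.re h
  simp at this
  linarith

lemma harmonicInterp.differentiableOn_right_half_plane :
    DifferentiableOn ℂ harmonicInterp {x : ℂ | 0 < x.re} :=
  harmonicInterp.differentiableOn.mono fun _ hx => re_gt_neg_half_of_pos hx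

lemma harmonicInterp.exists_norm_le : ∃ C : ℝ, 0 ≤ C ∧ ∀ x : ℂ, 0 < x.re → ‖harmonicInterp x‖ ≤ C * ‖x‖ :=
  ⟨∑' n : ℕ, 2 * (1 / ((n : ℝ) + 1) ^ 2), tsum_nonneg fun n => by positivity, fun _ hx =>
    (harmonicInterp.norm_le (re_gt_neg_half_of_pos hx)).trans (mul_comm _ _).le⟩

lemma harmonicInterp.expGrowthLT_exp_mul {z : ℂ} {τ : ℝ} (hz : ‖z‖ < τ) :
    ExpGrowthLT τ (fun x => Complex.exp (-x * z) * harmonicInterp x) := by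
  obtain ⟨C, hC0, hC⟩ := harmonicInterp.exists_norm_le
  refine ExpGrowthLT.of_norm_le (A := C) hz fun x hx => ?_
  rw [norm_mul, mul_comm]
  have h1 : ‖Complex.exp (-x * z)‖ ≤ Real.exp (‖z‖ * ‖x‖) := by
    refine (Complex.norm_exp_le_exp_norm _).trans (le_of_eq ?_)
    rw [norm_mul, norm_neg, mul_comm]
  refine mul_le_mul ((hC x hx).trans ?_) h1 (norm_nonneg _) (by positivity)
  gcongr
  linarith

lemma harmonicInterp.expGrowthLT {τ : ℝ} (hτ : 0 < τ) : ExpGrowthLT τ harmonicInterp := by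
  simpa using harmonicInterp.expGrowthLT_exp_mul (z := 0) (τ := τ) (by simpa using hτ)

lemma lerchIntegral.expGrowthLT_comp_add_one {z : ℂ} (hz : ‖z‖ < 2 * Real.pi) :
    ExpGrowthLT (2 * Real.pi) (fun x => lerchIntegral z (x + 1)) := by
  obtain ⟨C, hC0, hC⟩ := lerchIntegral.exists_norm_le hz
  refine ExpGrowthLT.of_norm_le (A := C * 2 * Real.exp ‖z‖) hz fun x _ => (hC (x + 1)).trans ?_
  have h1 : ‖x + 1‖ ≤ ‖x‖ + 1 := (norm_add_le _ _).trans (by simp)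
  have h2 := norm_nonneg x
  calc C * (1 + ‖x + 1‖) * Real.exp (‖z‖ * ‖x + 1‖)
      ≤ C * (2 * (1 + ‖x‖)) * Real.exp (‖z‖ * (‖x‖ + 1)) := by gcongr; linarith
    _ = _ := by rw [mul_add ‖z‖, Real.exp_add, mul_one]; ring

/-! ### Laplace transforms of ψ(x+1) and H over [0, 1]. -/

/-- The Laplace transform of `x ↦ ψ(x + 1)` on the unit interval. -/
noncomputable def digammaLaplace (z : ℂ) : ℂ :=
  ∫ x in (0 : ℝ)..1, Complex.digamma ((x : ℂ) + 1) * Complex.exp (-z * (x : ℂ))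

lemma continuousOn_digamma_add_one :
    ContinuousOn (fun x : ℝ => Complex.digamma ((x : ℂ) + 1)) (Set.Icc 0 1) := by
  have h : ContinuousOn (fun x : ℝ => harmonicInterp x - Real.eulerMascheroniConstant)
      (Set.Icc 0 1) :=
    (continuousOn_harmonicInterp_ofReal fun x hx => hx.1).sub continuousOn_const
  exact h.congr fun x hx => Complex.digamma_add_one_eq_harmonicInterp hx.1 hx.2

lemma ContinuousOn.intervalIntegrable_unit {f : ℝ → ℂ} (hf : ContinuousOn f (Set.Icc 0 1)) :
    IntervalIntegrable f MeasureTheory.volume 0 1 :=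
  ContinuousOn.intervalIntegrable (by rwa [Set.uIcc_of_le zero_le_one])

lemma integral_digamma_add_one : ∫ x in (0 : ℝ)..1, Complex.digamma ((x : ℂ) + 1) = 0 := by
  have h : ∫ x in (0 : ℝ)..1, Complex.digamma ((x : ℂ) + 1) =
      ∫ x in (0 : ℝ)..1, (harmonicInterp x - Real.eulerMascheroniConstant) := by
    refine intervalIntegral.integral_congr fun x hx => ?_
    rw [Set.uIcc_of_le zero_le_one] at hx
    exact Complex.digamma_add_one_eq_harmonicInterp hx.1 hx.2
  rw [h, intervalIntegral.integral_sub
    (continuousOn_harmonicInterp_ofReal fun x hx => hx.1).intervalIntegrable_unit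
    intervalIntegrable_const, integral_harmonicInterp]
  simp

lemma integral_exp_neg_mul (z : ℂ) :
    ∫ x in (0 : ℝ)..1, Complex.exp (-z * (x : ℂ)) = expQuot z := by
  have := integral_unit_eq_sub (F := fun s => s * expQuot (z * s))
    (f := fun s => Complex.exp (-z * s))
    (fun s _ => (expQuot.hasDerivAt_mul_comp z s).congr_deriv (by ring_nf)) (by fun_prop)
  rw [this]
  simp

lemma integral_exp_mul_harmonicInterp (z : ℂ) :
    ∫ x in (0 : ℝ)..1, harmonicInterp x * Complex.exp (-z * (x : ℂ)) =
      digammaLaplace z + Real.eulerMascheroniConstant * expQuot z := by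
  rw [digammaLaplace, ← integral_exp_neg_mul, ← intervalIntegral.integral_const_mul,
    ← intervalIntegral.integral_add]
  · refine intervalIntegral.integral_congr fun x hx => ?_
    rw [Set.uIcc_of_le zero_le_one] at hx
    rw [Complex.digamma_add_one_eq_harmonicInterp hx.1 hx.2]
    ring
  · exact (continuousOn_digamma_add_one.mul (by fun_prop)).intervalIntegrable_unit
  · exact Continuous.intervalIntegrable (by fun_prop) _ _

/-! ### The closed form for z ≠ 0. -/

/-- The closed form multiplied by `1 - e^{-z}`. -/
noncomputable def harmonicExpNumerator (z : ℂ) : ℂ :=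
  z / 2 - Complex.log (Complex.exp (z / 2) * expQuot z) - entireExpIntegral z +
    Real.eulerMascheroniConstant * (1 - Complex.exp (-z) * expQuot z) -
    Complex.exp (-z) * digammaLaplace z

lemma one_sub_exp_neg_ne_zero {z : ℂ} (hz : ‖z‖ < 2 * Real.pi) (h0 : z ≠ 0) :
    1 - Complex.exp (-z) ≠ 0 := by
  rw [← expQuot.mul_self]
  exact mul_ne_zero h0 (expQuot.ne_zero hz)

lemma harmonicExpClosedForm_eq {z : ℂ} (hz : ‖z‖ < Real.pi) (h0 : z ≠ 0) :
    harmonicExpClosedForm z = harmonicExpNumerator z / (1 - Complex.exp (-z)) := by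
  have hne := one_sub_exp_neg_ne_zero (by linarith [Real.pi_pos]) h0
  have hsum : ∑' n : ℕ, (-1 : ℂ) ^ (n + 1) / ((n + 1 : ℕ) : ℂ) *
      (z ^ (n + 1) / ((n + 1).factorial : ℂ)) = -entireExpIntegral z := by
    rw [entireExpIntegral, ← tsum_neg]
    refine tsum_congr fun n => ?_
    rw [pow_succ]
    ring
  have hexp : 1 / (Complex.exp z - 1) = Complex.exp (-z) / (1 - Complex.exp (-z)) := by
    have h1 : Complex.exp z - 1 = Complex.exp z * (1 - Complex.exp (-z)) := by
      rw [mul_sub, ← Complex.exp_add, add_neg_cancel, Complex.exp_zero, mul_one]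
    rw [h1, Complex.exp_neg]
    field_simp
  have hq : expQuot z = (1 - Complex.exp (-z)) / z := by
    rw [← expQuot.mul_self, mul_div_cancel_left₀ _ h0]
  rw [harmonicExpClosedForm, hsum, hexp,
    log_div_one_sub_exp_neg (lt_of_le_of_lt (Complex.abs_im_le_norm z) hz) h0, harmonicExpNumerator,
    ← digammaLaplace]
  generalize Complex.log (Complex.exp (z / 2) * expQuot z) = l
  rw [hq]
  field_simp
  ring

lemma integral_one_two_eq_integral_unit (f : ℂ → ℂ) :
    ∫ t in (1 : ℝ)..2, f t = ∫ t in (0 : ℝ)..1, f (t + 1) := by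
  have := intervalIntegral.integral_comp_add_right (a := 0) (b := 1) (fun t : ℝ => f t) 1
  norm_num at this
  rw [← this]

lemma hasRamanujanSum_closedForm {z : ℂ} (hz : ‖z‖ < Real.pi) (h0 : z ≠ 0) :
    HasRamanujanSum (fun n : ℕ => Complex.exp (-(n : ℂ) * z) * ((harmonic n : ℚ) : ℂ))
      (harmonicExpClosedForm z) := by
  have hz2 : ‖z‖ < 2 * Real.pi := by linarith [Real.pi_pos]
  have hne := one_sub_exp_neg_ne_zero hz2 h0
  have hH := harmonicInterp.differentiableOn_right_half_plane
  -- The difference equation fixes R only up to a constant; adding γ gives γ - H mean zero on [0,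
  -- 1].
  set R : ℂ → ℂ := fun x => (1 - Complex.exp (-z))⁻¹ *
    (Complex.exp (-x * z) * harmonicInterp x + (Real.eulerMascheroniConstant - harmonicInterp x +
      lerchIntegral z (x + 1))) with hRdef
  have hstep : ∀ x : ℂ, x ≠ 0 → lerchIntegral z (x + 1) =
      lerchIntegral z x + (1 - Complex.exp (-x * z)) / x := by
    intro x hx
    have h1 := expQuot.mul_self (x * z)
    rw [lerchIntegral.map_add_one hz2, neg_mul, ← h1]
    field_simp
  have key := hasRamanujanSum_of_difference
    (u := fun n : ℕ => Complex.exp (-(n : ℂ) * z) * ((harmonic n : ℚ) : ℂ))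
    (a := fun x => Complex.exp (-x * z) * harmonicInterp x) (R := R)
    (DifferentiableOn.mul (by fun_prop) hH) (harmonicInterp.expGrowthLT_exp_mul hz)
    (fun n _ => by simp only [harmonicInterp.map_natCast])
    (by
      have hL := lerchIntegral.differentiable hz2
      have hL' : Differentiable ℂ fun x => lerchIntegral z (x + 1) := hL.comp (by fun_prop)
      have h1 : DifferentiableOn ℂ (fun x => Complex.exp (-x * z) * harmonicInterp x)
        {x : ℂ | 0 < x.re} := DifferentiableOn.mul (by fun_prop) hH
      exact (h1.add (((differentiableOn_const _).sub hH).add hL'.differentiableOn)).const_mul _)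
    (((harmonicInterp.expGrowthLT_exp_mul hz2).add
      (((ExpGrowthLT.const Real.two_pi_pos _).sub (harmonicInterp.expGrowthLT Real.two_pi_pos)).add
        (lerchIntegral.expGrowthLT_comp_add_one hz2))).const_mul _)
    (fun x hx => by
      have hx1 := add_one_ne_zero_of_re_pos hx
      have h1 := harmonicInterp.map_add_one (re_gt_neg_half_of_pos hx)
      have h2 := hstep (x + 1) hx1
      have h3 : Complex.exp (-(x + 1) * z) = Complex.exp (-x * z) * Complex.exp (-z) := by
        rw [← Complex.exp_add]; ring_nf
      rw [h3] at h2
      rw [hRdef]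
      simp only
      rw [h1, h2, h3]
      field_simp
      ring)
  convert key using 1
  have hint : ∫ t in (1 : ℝ)..2, R t = (1 - Complex.exp (-z))⁻¹ *
      (Complex.exp (-z) * (digammaLaplace z + Real.eulerMascheroniConstant * expQuot z) +
        entireExpIntegral z) := by
    have hL : Continuous fun t : ℝ => lerchIntegral z (t + 1) :=
      (lerchIntegral.differentiable hz2).continuous.comp (by fun_prop)
    have hHc := continuousOn_harmonicInterp_ofReal (s := Set.Icc 0 1) fun x hx => hx.1
    -- Rewriting H(t+1) and Λ_z(t+2) through H(t) and Λ_z(t+1) produces terms over t+1 that all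
    -- cancel.
    have hsplit : ∫ t in (0 : ℝ)..1, R (t + 1) = ∫ t in (0 : ℝ)..1, (1 - Complex.exp (-z))⁻¹ *
        (Complex.exp (-z) * (harmonicInterp t * Complex.exp (-z * (t : ℂ))) +
          ((Real.eulerMascheroniConstant - harmonicInterp t) + lerchIntegral z (t + 1))) := by
      refine intervalIntegral.integral_congr fun t ht => ?_
      rw [Set.uIcc_of_le zero_le_one] at ht
      have ht1 : (t : ℂ) + 1 ≠ 0 := by
        have : (0 : ℝ) < t + 1 := by linarith [ht.1]
        exact_mod_cast this.ne'
      have h1 := harmonicInterp.map_add_one (x := t) (by simp; linarith [ht.1])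
      have h2 := hstep (t + 1) ht1
      have h3 : Complex.exp (-(t + 1) * z) = Complex.exp (-z) * Complex.exp (-z * (t : ℂ)) := by
        rw [← Complex.exp_add]; ring_nf
      rw [h3] at h2
      rw [hRdef]
      simp only
      rw [h1, h2, h3]
      congr 1
      field_simp
      ring
    have hiγ : IntervalIntegrable (fun t : ℝ => (Real.eulerMascheroniConstant : ℂ) - harmonicInterp t)
        MeasureTheory.volume 0 1 := (continuousOn_const.sub hHc).intervalIntegrable_unit
    have hiL : IntervalIntegrable (fun t : ℝ => lerchIntegral z (t + 1)) MeasureTheory.volume 0 1 :=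
      hL.intervalIntegrable _ _
    have hi1 : IntervalIntegrable (fun t : ℝ => Complex.exp (-z) *
        (harmonicInterp t * Complex.exp (-z * (t : ℂ)))) MeasureTheory.volume 0 1 :=
      (continuousOn_const.mul (hHc.mul (by fun_prop))).intervalIntegrable_unit
    rw [integral_one_two_eq_integral_unit, hsplit, intervalIntegral.integral_const_mul,
      intervalIntegral.integral_add hi1 (hiγ.add hiL), intervalIntegral.integral_add hiγ hiL,
      intervalIntegral.integral_const_mul, integral_exp_mul_harmonicInterp,
      intervalIntegral.integral_sub intervalIntegrable_const hHc.intervalIntegrable_unit,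
      integral_harmonicInterp, ← integral_one_two_eq_integral_unit,
      lerchIntegral.intervalIntegral_eq hz2]
    simp
  have hone : harmonicInterp 1 = 1 := by
    have := harmonicInterp.map_natCast 1
    simpa using this
  have hL1 := hstep 1 one_ne_zero
  rw [hint, hRdef, harmonicExpClosedForm_eq hz h0, harmonicExpNumerator, ← lerchIntegral.map_one hz]
  simp only
  rw [hone, hL1, neg_one_mul]
  field_simp
  ring

/-! ### The case z = 0. -/

lemma harmonicExpNumerator_zero : harmonicExpNumerator 0 = 0 := by
  have : digammaLaplace 0 = 0 := by
    refine Eq.trans ?_ integral_digamma_add_one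
    simp [digammaLaplace]
  simp [harmonicExpNumerator, expQuot.map_zero, entireExpIntegral.map_zero, this]

/-- The logarithm contributes nothing, sinh(z/2)/(z/2) being even; e^{-z}φ(z) has derivative -3/2;
the Laplace transform vanishes at 0, so only its own derivative enters. -/
lemma hasDerivAt_harmonicExpNumerator :
    HasDerivAt harmonicExpNumerator (-(1 / 2) + 3 / 2 * Real.eulerMascheroniConstant +
      ∫ x in (0 : ℝ)..1, (x : ℂ) * Complex.digamma ((x : ℂ) + 1)) 0 := by
  have h1 : HasDerivAt (fun z : ℂ => z / 2) (1 / 2) 0 := (hasDerivAt_id 0).div_const 2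
  have hq : HasDerivAt expQuot (-(1 / 2)) 0 := by
    rw [← expQuot.deriv_zero]; exact (expQuot.differentiable 0).hasDerivAt
  have h2 : HasDerivAt (fun z : ℂ => Complex.log (Complex.exp (z / 2) * expQuot z)) 0 0 := by
    have h := HasDerivAt.clog (h1.cexp.fun_mul hq) (by simp [expQuot.map_zero])
    refine h.congr_deriv ?_
    simp [expQuot.map_zero]
  have h3 : HasDerivAt entireExpIntegral 1 0 := by
    rw [← expQuot.map_zero]; exact entireExpIntegral.hasDerivAt 0
  have hexp : HasDerivAt (fun z : ℂ => Complex.exp (-z)) (-1) 0 := by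
    refine (hasDerivAt_neg (0 : ℂ)).cexp.congr_deriv ?_
    simp
  have hΨ := hasDerivAt_integral_mul_exp continuousOn_digamma_add_one 0
  have hΨ0 : ∫ x in (0 : ℝ)..1, Complex.digamma ((x : ℂ) + 1) * Complex.exp (-0 * (x : ℂ)) = 0 := by
    refine Eq.trans ?_ integral_digamma_add_one
    simp
  have hΨ' : ∫ x in (0 : ℝ)..1, -(x : ℂ) * (Complex.digamma ((x : ℂ) + 1) * Complex.exp (-0 * (x : ℂ))) =
      -∫ x in (0 : ℝ)..1, (x : ℂ) * Complex.digamma ((x : ℂ) + 1) := by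
    rw [← intervalIntegral.integral_neg]; simp
  rw [hΨ'] at hΨ
  have h := (((h1.fun_sub h2).fun_sub h3).fun_add
    (((hexp.fun_mul hq).const_sub 1).const_mul (Real.eulerMascheroniConstant : ℂ))).fun_sub
    (hexp.fun_mul hΨ)
  refine h.congr_deriv ?_
  rw [hΨ0, expQuot.map_zero, neg_zero, Complex.exp_zero]
  ring

-- The numerator vanishes at 0 and 1 - e^{-z} = zφ(z) with φ(0) = 1, so the limit is the derivative
-- of the numerator.
open Filter in
lemma tendsto_harmonicExpClosedForm :
    Tendsto harmonicExpClosedForm (nhdsWithin 0 {(0 : ℂ)}ᶜ)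
      (nhds (-(1 / 2) + 3 / 2 * Real.eulerMascheroniConstant +
        ∫ x in (0 : ℝ)..1, (x : ℂ) * Complex.digamma ((x : ℂ) + 1))) := by
  have h1 := hasDerivAt_iff_tendsto_slope.1 hasDerivAt_harmonicExpNumerator
  have h2 : Tendsto expQuot (nhdsWithin 0 {(0 : ℂ)}ᶜ) (nhds 1) := by
    rw [← expQuot.map_zero]
    exact expQuot.differentiable.continuous.continuousAt.mono_left nhdsWithin_le_nhds
  have h3 := h1.div h2 one_ne_zero
  rw [div_one] at h3
  refine h3.congr' ?_
  have hball : ∀ᶠ z : ℂ in nhdsWithin 0 {(0 : ℂ)}ᶜ, ‖z‖ < Real.pi :=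
    nhdsWithin_le_nhds (by simpa [Metric.ball, dist_eq_norm] using Metric.ball_mem_nhds (0 : ℂ) Real.pi_pos)
  filter_upwards [hball, self_mem_nhdsWithin] with z hz h0
  have h0' : z ≠ 0 := h0
  rw [harmonicExpClosedForm_eq hz h0', Pi.div_apply, slope_def_field, harmonicExpNumerator_zero,
    sub_zero, sub_zero, ← expQuot.mul_self, div_div]

lemma hasRamanujanSum_harmonic :
    HasRamanujanSum (fun n : ℕ => ((harmonic n : ℚ) : ℂ))
      (-(1 / 2) + 3 / 2 * Real.eulerMascheroniConstant +
        ∫ x in (0 : ℝ)..1, (x : ℂ) * Complex.digamma ((x : ℂ) + 1)) := by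
  have hH := harmonicInterp.differentiableOn_right_half_plane
  have hHc := continuousOn_harmonicInterp_ofReal (s := Set.Icc 0 1) fun x hx => hx.1
  -- Summation by parts: (x+1)H(x+1) - xH(x) = H(x) + 1, and the term x removes the 1.
  set R : ℂ → ℂ := fun x => x - x * harmonicInterp x with hRdef
  have key := hasRamanujanSum_of_difference
    (u := fun n : ℕ => ((harmonic n : ℚ) : ℂ)) (a := harmonicInterp) (R := R)
    hH (harmonicInterp.expGrowthLT Real.pi_pos) (fun n _ => harmonicInterp.map_natCast n)
    (differentiableOn_id.sub (differentiableOn_id.mul hH))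
    (by
      obtain ⟨C, hC0, hC⟩ := harmonicInterp.exists_norm_le
      have h1 : ExpGrowthLT (2 * Real.pi) fun x => x :=
        ExpGrowthLT.of_norm_le (A := 1) Real.two_pi_pos fun x _ => by simp
      have h2 : ExpGrowthLT (2 * Real.pi) fun x => x * harmonicInterp x :=
        ExpGrowthLT.of_norm_le (A := C) (r := 1) (by linarith [Real.pi_gt_three]) fun x hx => by
          have h3 := hC x hx
          have h4 : ‖x‖ ≤ Real.exp (1 * ‖x‖) := by
            rw [one_mul]; linarith [Real.add_one_le_exp ‖x‖]
          rw [norm_mul, mul_comm]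
          refine mul_le_mul (h3.trans ?_) h4 (norm_nonneg _) (by positivity)
          gcongr
          linarith
      exact h1.sub h2)
    (fun x hx => by
      have hx1 := add_one_ne_zero_of_re_pos hx
      rw [hRdef]
      simp only
      rw [harmonicInterp.map_add_one (re_gt_neg_half_of_pos hx)]
      field_simp
      ring)
  convert key using 1
  have hone : harmonicInterp 1 = 1 := by
    have := harmonicInterp.map_natCast 1
    simpa using this
  have hψ : ∫ x in (0 : ℝ)..1, (x : ℂ) * Complex.digamma ((x : ℂ) + 1) =
      (∫ x in (0 : ℝ)..1, (x : ℂ) * harmonicInterp x) - Real.eulerMascheroniConstant / 2 := by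
    have h1 : ∫ x in (0 : ℝ)..1, (x : ℂ) * Complex.digamma ((x : ℂ) + 1) =
        ∫ x in (0 : ℝ)..1, ((x : ℂ) * harmonicInterp x - (x : ℂ) * Real.eulerMascheroniConstant) := by
      refine intervalIntegral.integral_congr fun x hx => ?_
      rw [Set.uIcc_of_le zero_le_one] at hx
      rw [Complex.digamma_add_one_eq_harmonicInterp hx.1 hx.2]
      ring
    have h2 : ∫ x in (0 : ℝ)..1, (x : ℂ) = 1 / 2 := by
      rw [intervalIntegral.integral_ofReal, integral_id]
      norm_num
    have hi1 : IntervalIntegrable (fun t : ℝ => (t : ℂ) * harmonicInterp t) MeasureTheory.volume 0 1 :=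
      ContinuousOn.intervalIntegrable_unit (ContinuousOn.mul (by fun_prop) hHc)
    have hi2 : IntervalIntegrable (fun t : ℝ => (t : ℂ) * Real.eulerMascheroniConstant)
        MeasureTheory.volume 0 1 := Continuous.intervalIntegrable (by fun_prop) _ _
    rw [h1, intervalIntegral.integral_sub hi1 hi2, intervalIntegral.integral_mul_const, h2]
    ring
  have hint : ∫ t in (1 : ℝ)..2, R t = 1 / 2 -
      (∫ x in (0 : ℝ)..1, (x : ℂ) * harmonicInterp x) - Real.eulerMascheroniConstant := by
    have h1 : ∫ t in (0 : ℝ)..1, R (t + 1) =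
        ∫ t in (0 : ℝ)..1, ((t : ℂ) - (t : ℂ) * harmonicInterp t - harmonicInterp t) := by
      refine intervalIntegral.integral_congr fun t ht => ?_
      rw [Set.uIcc_of_le zero_le_one] at ht
      have ht1 : (t : ℂ) + 1 ≠ 0 := by
        have : (0 : ℝ) < t + 1 := by linarith [ht.1]
        exact_mod_cast this.ne'
      rw [hRdef]
      simp only
      rw [harmonicInterp.map_add_one (x := t) (by simp; linarith [ht.1])]
      field_simp
      ring
    have hi1 : IntervalIntegrable (fun t : ℝ => (t : ℂ) * harmonicInterp t) MeasureTheory.volume 0 1 :=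
      ContinuousOn.intervalIntegrable_unit (ContinuousOn.mul (by fun_prop) hHc)
    have hi2 : IntervalIntegrable (fun t : ℝ => (t : ℂ)) MeasureTheory.volume 0 1 :=
      Continuous.intervalIntegrable (by fun_prop) _ _
    have h2 : ∫ x in (0 : ℝ)..1, (x : ℂ) = 1 / 2 := by
      rw [intervalIntegral.integral_ofReal, integral_id]
      norm_num
    rw [integral_one_two_eq_integral_unit, h1, intervalIntegral.integral_sub (hi2.sub hi1)
      hHc.intervalIntegrable_unit, intervalIntegral.integral_sub hi2 hi1, h2, integral_harmonicInterp]
  rw [hint, hψ, hRdef]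
  simp only
  rw [hone]
  ring

/-- For `0 < |z| < π` the Ramanujan sum of `∑ e^{-nz} H_n` is the closed form; at `z = 0`, where the
closed form has a removable singularity, the Ramanujan sum of `∑ H_n` is its limit. -/
theorem lemma2 :
    (∀ z : ℂ, ‖z‖ < Real.pi → z ≠ 0 →
      RamanujanSumEq (fun n : ℕ => Complex.exp (-(n : ℂ) * z) * ((harmonic n : ℚ) : ℂ))
        (harmonicExpClosedForm z)) ∧
    (∃ s : ℂ, Filter.Tendsto harmonicExpClosedForm (nhdsWithin (0 : ℂ) {(0 : ℂ)}ᶜ) (nhds s) ∧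
      RamanujanSumEq (fun n : ℕ => ((harmonic n : ℚ) : ℂ)) s) := by
  exact ⟨fun z hz h0 => ⟨hasRamanujanSum_closedForm hz h0, fun t ht =>
      ht.unique (hasRamanujanSum_closedForm hz h0)⟩,
    _, tendsto_harmonicExpClosedForm, hasRamanujanSum_harmonic, fun t ht =>
      ht.unique hasRamanujanSum_harmonic⟩
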